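/- Let $\mathbb{M}_{n_1,n_2}$ be the space of real or complex $n_1\times n_2$ matrices with the Frobenius norm $\|\cdot\|$ and singular values $\sigma_1(X)\ge\sigma_2(X)\ge\dots\ge\sigma_n(X)\ge 0$, $n=\min(n_1,n_2)$. Let $\mathcal{A}$ be a (real-)linear operator from $\mathbb{M}_{n_1,n_2}$ to a finite-dimensional real inner product space (for instance $\mathbb{R}^m$, or $\mathbb{C}^m$ regarded as a real space), with operator norm $\|\mathcal{A}\|$. For $k\ge 1$ let the lower restricted isometry constant $\delta_k^-$ be defined by $$1-\delta_k^-=\inf\left\{\frac{\|\mathcal{A}X\|^2}{\|X\|^2} : X\neq 0,\ \operatorname{rank}(X)\le k\right\},$$ let $r_\mu(s)=\mu-\max(\sqrt{\mu}-s,0)^2$ for $\mu>0$, and put $$\mathcal{R}_{\mu,reg}(X)=\sum_{i=1}^n r_\mu(\sigma_i(X))+\|\mathcal{A}X-b\|^2,\qquad \mathcal{R}_\mu(X)=\mu\operatorname{rank}(X)+\|\mathcal{A}X-b\|^2 .$$ A matrix $X$ is called a stationary point of a functional $g$ if $$\liminf_{Y\to X,\ Y\neq X}\frac{g(Y)-g(X)}{\|Y-X\|}\ge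 0 .$$ Theorem. Let $b=\mathcal{A}X_0+\epsilon$, where $\|\mathcal{A}\|<1$ and $\operatorname{rank}(X_0)=K\ge 1$, let $\delta_{2K}^-<1$ and $\mu>0$, and assume that $$\|\epsilon\|\le\frac{(1-\delta_{2K}^-)^{3/2}\sqrt{\mu}}{3}\qquad\text{and}\qquad \sigma_K(X_0)>\left(\frac{1}{1-\delta_{2K}^-}+(1-\delta_{2K}^-)\right)\sqrt{\mu}.$$ Then the problem $\operatorname{argmin}_{\operatorname{rank}(X)\le K}\|\mathcal{A}X-b\|$ has a unique solution $X_B$, and $X_B$ is the unique global minimizer of $\mathcal{R}_{\mu,reg}$ as well as the unique global minimizer of $\mathcal{R}_\mu$. Moreover $$\|X_B-X_0\|\le\frac{2\|\epsilon\|}{\sqrt{1-\delta_{2K}^-}},$$ $X_B$ is a stationary point of $\mathcal{R}_{\mu,reg}$, and every other stationary point $X$ of $\mathcal{R}_{\mu,reg}$ satisfies $\operatorname{rank}(X)>K$. -/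

import Mathlib

open Filter Topology

attribute [local instance] Matrix.frobeniusNormedAddCommGroup Matrix.frobeniusNormedSpace

noncomputable section

/-- `singVal X j` is the `j`-th singular value `σ_j(X)`, `j = 1, 2, …`, in non-increasing order and
with multiplicity (Mathlib numbers the singular values from `0`). -/
def singVal {𝕜 : Type*} [RCLike 𝕜] {n₁ n₂ : ℕ} (X : Matrix (Fin n₁) (Fin n₂) 𝕜) (j : ℕ) : ℝ :=
  (Matrix.toEuclideanLin X).singularValues (j - 1)

/-- The operator norm of `A` with respect to the Frobenius norm on matrices: the least `c ≥ 0` with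
`‖A X‖ ≤ c ‖X‖_F` for all `X`. (The matrix norm in this file is Mathlib's Frobenius norm.) -/
def opNorm {𝕜 : Type*} [RCLike 𝕜] {n₁ n₂ : ℕ}
    {F : Type*} [NormedAddCommGroup F] [InnerProductSpace ℝ F]
    (A : Matrix (Fin n₁) (Fin n₂) 𝕜 →ₗ[ℝ] F) : ℝ :=
  sInf {c : ℝ | 0 ≤ c ∧ ∀ X : Matrix (Fin n₁) (Fin n₂) 𝕜, ‖A X‖ ≤ c * ‖X‖}

/-- The lower restricted isometry constant `δ_K⁻` of `A`, determined by
`1 - δ_K⁻ = inf { ‖A X‖² / ‖X‖_F² : X ≠ 0, rank X ≤ K }`. -/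
def lripConst {𝕜 : Type*} [RCLike 𝕜] {n₁ n₂ : ℕ}
    {F : Type*} [NormedAddCommGroup F] [InnerProductSpace ℝ F]
    (A : Matrix (Fin n₁) (Fin n₂) 𝕜 →ₗ[ℝ] F) (K : ℕ) : ℝ :=
  1 - sInf {q : ℝ | ∃ X : Matrix (Fin n₁) (Fin n₂) 𝕜, X ≠ 0 ∧ X.rank ≤ K ∧
    q = ‖A X‖ ^ 2 / ‖X‖ ^ 2}

/-- `r_μ(s) = μ - max(√μ - s, 0)²`. -/
def rMu (μ s : ℝ) : ℝ := μ - max (√μ - s) 0 ^ 2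

/-- `μ rank(X) + ‖A X - b‖²`. -/
def rankFunctional {𝕜 : Type*} [RCLike 𝕜] {n₁ n₂ : ℕ}
    {F : Type*} [NormedAddCommGroup F] [InnerProductSpace ℝ F]
    (A : Matrix (Fin n₁) (Fin n₂) 𝕜 →ₗ[ℝ] F) (b : F) (μ : ℝ)
    (X : Matrix (Fin n₁) (Fin n₂) 𝕜) : ℝ :=
  μ * (X.rank : ℝ) + ‖A X - b‖ ^ 2

/-- `∑ᵢ r_μ(σᵢ(X)) + ‖A X - b‖²`. -/
def regFunctional {𝕜 : Type*} [RCLike 𝕜] {n₁ n₂ : ℕ}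
    {F : Type*} [NormedAddCommGroup F] [InnerProductSpace ℝ F]
    (A : Matrix (Fin n₁) (Fin n₂) 𝕜 →ₗ[ℝ] F) (b : F) (μ : ℝ)
    (X : Matrix (Fin n₁) (Fin n₂) 𝕜) : ℝ :=
  (∑ i ∈ Finset.Icc 1 (min n₁ n₂), rMu μ (singVal X i)) + ‖A X - b‖ ^ 2

/-- The set of solutions of `argmin_{rank X ≤ K} ‖A X - b‖`. -/
def bestRankSolutions {𝕜 : Type*} [RCLike 𝕜] {n₁ n₂ : ℕ}
    {F : Type*} [NormedAddCommGroup F] [InnerProductSpace ℝ F]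
    (A : Matrix (Fin n₁) (Fin n₂) 𝕜 →ₗ[ℝ] F) (b : F) (K : ℕ) :
    Set (Matrix (Fin n₁) (Fin n₂) 𝕜) :=
  {X | X.rank ≤ K ∧ ∀ Y : Matrix (Fin n₁) (Fin n₂) 𝕜, Y.rank ≤ K → ‖A X - b‖ ≤ ‖A Y - b‖}

/-- The set of global minimizers of `g`. -/
def globalMinimizers {E : Type*} (g : E → ℝ) : Set E := {X | ∀ Y, g X ≤ g Y}

/-- `X` is stationary for `g` if `liminf_{Y → X, Y ≠ X} (g(Y) - g(X)) / ‖Y - X‖ ≥ 0`; the lower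
limit is taken in the extended reals. -/
def IsStationaryPt {E : Type*} [NormedAddCommGroup E] (g : E → ℝ) (X : E) : Prop :=
  0 ≤ liminf (fun Y => (((g Y - g X) / ‖Y - X‖ : ℝ) : EReal)) (𝓝[≠] X)

end

/-!
Since `rMu μ` is strictly concave below `√μ` with second derivative `-2`, while `‖A X‖ < ‖X‖`, the
functional `regFunctional A b μ`, restricted to the matrices with prescribed singular vectors,
decreases strictly when all singular values in `(0, √μ)` are moved to the endpoints, where it agrees
with `rankFunctional A b μ`. So the two functionals have the same global minimizers. Those of
`rankFunctional A b μ` have rank `K`: a matrix of lower rank is too far from `X₀` by the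
Eckart–Young bound and restricted isometry, and each additional rank costs more than the noise.

Uniqueness comes from writing half of `regFunctional A b μ` as the convex function
`(‖X‖ ^ 2 + ∑ᵢ rMu μ (σᵢ X)) / 2` plus `(‖A X - b‖ ^ 2 - ‖X‖ ^ 2) / 2`. A best rank `K` solution `B`
has no singular values in `(0, √μ / γ)`, and `A* (b - A B)` is orthogonal to all `B Z` and `Z B` and
of norm at most `γ * √μ`. Along the segment from such a `B` to `X`, the subgradients of the convex
part are strongly monotone with constant `1 - γ`. If `X` is stationary, this forces
`‖A (X - B)‖ ^ 2 ≤ γ * ‖X - B‖ ^ 2`, which restricted isometry forbids when `X ≠ B` has rank at most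
`K`, because `γ < 1 - lripConst A (2 * K)`.
-/

theorem rMu_zero {μ : ℝ} (hμ : 0 ≤ μ) : rMu μ 0 = 0 := by
  simp [rMu, Real.sq_sqrt hμ]

theorem rMu_le (μ s : ℝ) : rMu μ s ≤ μ :=
  sub_le_self _ (sq_nonneg _)

theorem rMu_of_sqrt_le {μ s : ℝ} (h : √μ ≤ s) : rMu μ s = μ := by
  simp [rMu, h]

theorem rMu_of_le_sqrt {μ s : ℝ} (hμ : 0 ≤ μ) (h : s ≤ √μ) :
    rMu μ s = 2 * √μ * s - s ^ 2 := by
  rw [rMu, max_eq_left (sub_nonneg.2 h), sub_sq, Real.sq_sqrt hμ]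
  ring

/-- `s ^ 2 + rMu μ s` is convex on `[0, ∞)`, with subgradient `2 * max √μ y` at `y`. -/
theorem sq_add_rMu_subgradient {μ x y : ℝ} (hμ : 0 ≤ μ) :
    y ^ 2 + rMu μ y + 2 * max (√μ) y * (x - y) ≤ x ^ 2 + rMu μ x := by
  have hs := Real.sq_sqrt hμ
  rcases le_total y (√μ) with hy | hy <;> rcases le_total x (√μ) with hx | hx
  · rw [rMu_of_le_sqrt hμ hy, rMu_of_le_sqrt hμ hx, max_eq_left hy]
    linarith
  · rw [rMu_of_le_sqrt hμ hy, rMu_of_sqrt_le hx, max_eq_left hy]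
    linarith [sq_nonneg (x - √μ)]
  · rw [rMu_of_sqrt_le hy, rMu_of_le_sqrt hμ hx, max_eq_right hy]
    nlinarith [mul_nonneg (sub_nonneg.2 hy) (sub_nonneg.2 hx), sq_nonneg (y - √μ)]
  · rw [rMu_of_sqrt_le hy, rMu_of_sqrt_le hx, max_eq_right hy]
    linarith [sq_nonneg (x - y)]

/-- Strong monotonicity `(1 - γ) * (y - x) ^ 2 ≤ (max a y - x) * (y - x)`, with an error `e * y`
at `x = 0`, rearranged so that the cross terms stand on the left. -/
theorem max_sub_mul_add_ite_mul_le {a γ e x y : ℝ} (hγ : 0 < γ) (hγ1 : γ < 1) (ha : 0 < a)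
    (hy : 0 ≤ y) (he : e ≤ γ * a) (hx : x = 0 ∨ a ≤ γ * x) :
    (max a y - (1 - 2 * γ) * y) * x + (if x = 0 then e else 0) * y ≤
      (max a y * y - (1 - γ) * y ^ 2) + γ * x ^ 2 := by
  rcases hx with rfl | hx
  · have hmax : 0 ≤ (max a y - y) * y := mul_nonneg (by linarith [le_max_right a y]) hy
    have ha_max : 0 ≤ γ * (max a y - a) * y :=
      mul_nonneg (mul_nonneg hγ.le (by linarith [le_max_left a y])) hy
    rw [if_pos rfl]
    nlinarith [mul_nonneg hy (sub_nonneg.2 he), mul_nonneg (sub_nonneg.2 hγ1.le) hmax]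
  · have hx0 : 0 < x := pos_of_mul_pos_right (ha.trans_le hx) hγ.le
    rw [if_neg hx0.ne']
    rcases le_total y a with h | h
    · rw [max_eq_left h]
      have hax : a ≤ x := hx.trans (mul_le_of_le_one_left hx0.le hγ1.le)
      have : 0 ≤ (x - y) * (γ * x - a + (1 - γ) * y) :=
        mul_nonneg (by linarith) (by nlinarith)
      linarith
    · rw [max_eq_right h]
      nlinarith [sq_nonneg (y - x)]

noncomputable section

/-- The real inner product `Re tr(Xᴴ Y)` inducing the Frobenius norm. -/
abbrev frobeniusInnerProductSpace {𝕜 : Type*} [RCLike 𝕜] {n₁ n₂ : ℕ} :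
    InnerProductSpace ℝ (Matrix (Fin n₁) (Fin n₂) 𝕜) where
  inner X Y := ∑ i, ∑ j, RCLike.re (starRingEnd 𝕜 (X i j) * Y i j)
  norm_sq_eq_re_inner X := by
    have h : (0 : ℝ) ≤ ∑ i, ∑ j, ‖X i j‖ ^ (2 : ℝ) := by positivity
    rw [Matrix.frobenius_norm_def, ← Real.sqrt_eq_rpow, Real.sq_sqrt h, RCLike.re_to_real]
    refine Finset.sum_congr rfl fun i _ => Finset.sum_congr rfl fun j _ => ?_
    rw [RCLike.conj_mul, ← RCLike.ofReal_pow, RCLike.ofReal_re, Real.rpow_two]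
  conj_inner_symm X Y := by
    rw [conj_trivial]
    refine Finset.sum_congr rfl fun i _ => Finset.sum_congr rfl fun j _ => ?_
    rw [← RCLike.conj_re, map_mul, RCLike.conj_conj, mul_comm]
  add_left X Y Z := by
    simp [add_mul, Finset.sum_add_distrib]
  smul_left X Y r := by
    simp only [Matrix.smul_apply, RCLike.real_smul_eq_coe_mul, map_mul, RCLike.conj_ofReal,
      conj_trivial, Finset.mul_sum, mul_assoc, RCLike.re_ofReal_mul]

attribute [local instance] frobeniusInnerProductSpace

section Outer

variable {𝕜 : Type*} [RCLike 𝕜] {n₁ n₂ : ℕ}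

/-- The rank-one matrix `p q*`. -/
def outer (p : EuclideanSpace 𝕜 (Fin n₁)) (q : EuclideanSpace 𝕜 (Fin n₂)) :
    Matrix (Fin n₁) (Fin n₂) 𝕜 :=
  Matrix.vecMulVec p (star q)

theorem toEuclideanLin_outer (p : EuclideanSpace 𝕜 (Fin n₁)) (q x : EuclideanSpace 𝕜 (Fin n₂)) :
    Matrix.toEuclideanLin (outer p q) x = inner 𝕜 q x • p := by
  ext i
  simp only [outer, Matrix.toLpLin_apply, Matrix.mulVec, dotProduct, Matrix.vecMulVec_apply,
    PiLp.inner_apply, PiLp.smul_apply, smul_eq_mul, Finset.sum_mul, RCLike.inner_apply]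
  refine Finset.sum_congr rfl fun j _ => ?_
  simp [mul_comm, mul_left_comm]

theorem toEuclideanLin_real_smul (r : ℝ) (X : Matrix (Fin n₁) (Fin n₂) 𝕜)
    (x : EuclideanSpace 𝕜 (Fin n₂)) :
    Matrix.toEuclideanLin (r • X) x = (r : 𝕜) • Matrix.toEuclideanLin X x := by
  rw [RCLike.real_smul_eq_coe_smul (K := 𝕜), map_smul, LinearMap.smul_apply]

theorem outer_add_left (p p' : EuclideanSpace 𝕜 (Fin n₁)) (q : EuclideanSpace 𝕜 (Fin n₂)) :
    outer (p + p') q = outer p q + outer p' q :=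
  Matrix.add_vecMulVec _ _ _

theorem outer_add_right (p : EuclideanSpace 𝕜 (Fin n₁)) (q q' : EuclideanSpace 𝕜 (Fin n₂)) :
    outer p (q + q') = outer p q + outer p q' := by
  simp only [outer, WithLp.ofLp_add, star_add, Matrix.vecMulVec_add]

theorem real_smul_outer (r : ℝ) (p : EuclideanSpace 𝕜 (Fin n₁)) (q : EuclideanSpace 𝕜 (Fin n₂)) :
    r • outer p q = outer ((r : 𝕜) • p) q := by
  rw [RCLike.real_smul_eq_coe_smul (K := 𝕜)]
  exact (Matrix.smul_vecMulVec _ _ _).symm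

theorem mul_outer {n : ℕ} (X : Matrix (Fin n₁) (Fin n) 𝕜) (p : EuclideanSpace 𝕜 (Fin n))
    (q : EuclideanSpace 𝕜 (Fin n₂)) :
    X * outer p q = outer (Matrix.toEuclideanLin X p) q :=
  Matrix.mul_vecMulVec _ _ _

theorem outer_conjTranspose (p : EuclideanSpace 𝕜 (Fin n₁)) (q : EuclideanSpace 𝕜 (Fin n₂)) :
    (outer p q).conjTranspose = outer q p := by
  simp [outer, Matrix.conjTranspose_vecMulVec]

theorem outer_mul {n : ℕ} (X : Matrix (Fin n) (Fin n₂) 𝕜) (p : EuclideanSpace 𝕜 (Fin n₁))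
    (q : EuclideanSpace 𝕜 (Fin n)) :
    outer p q * X = outer p (Matrix.toEuclideanLin X.conjTranspose q) := by
  rw [← Matrix.conjTranspose_inj, Matrix.conjTranspose_mul, outer_conjTranspose,
    outer_conjTranspose, mul_outer]

theorem inner_outer_left (p : EuclideanSpace 𝕜 (Fin n₁)) (q : EuclideanSpace 𝕜 (Fin n₂))
    (X : Matrix (Fin n₁) (Fin n₂) 𝕜) :
    inner ℝ (outer p q) X = RCLike.re (inner 𝕜 p (Matrix.toEuclideanLin X q)) := by
  change ∑ i, ∑ j, RCLike.re (starRingEnd 𝕜 (outer p q i j) * X i j) = _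
  simp only [PiLp.inner_apply, RCLike.inner_apply, map_sum]
  refine Finset.sum_congr rfl fun i _ => ?_
  rw [← map_sum]
  congr 1
  simp only [Matrix.toLpLin_apply, Matrix.mulVec, dotProduct, Finset.sum_mul]
  refine Finset.sum_congr rfl fun j _ => ?_
  simp only [outer, Matrix.vecMulVec_apply, Pi.star_apply, map_mul, RCLike.star_def,
    RCLike.conj_conj]
  ring

theorem inner_outer_outer (p p' : EuclideanSpace 𝕜 (Fin n₁)) (q q' : EuclideanSpace 𝕜 (Fin n₂)) :
    inner ℝ (outer p q) (outer p' q') = RCLike.re (inner 𝕜 p p' * inner 𝕜 q' q) := by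
  rw [inner_outer_left, toEuclideanLin_outer, inner_smul_right, mul_comm]

theorem norm_outer (p : EuclideanSpace 𝕜 (Fin n₁)) (q : EuclideanSpace 𝕜 (Fin n₂)) :
    ‖outer p q‖ = ‖p‖ * ‖q‖ := by
  have h : ‖outer p q‖ ^ 2 = (‖p‖ * ‖q‖) ^ 2 := by
    rw [← real_inner_self_eq_norm_sq, inner_outer_outer, inner_self_eq_norm_sq_to_K,
      inner_self_eq_norm_sq_to_K]
    norm_cast
    ring
  exact (sq_eq_sq₀ (norm_nonneg _) (by positivity)).1 h

end Outer

section Rank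

variable {𝕜 : Type*} [RCLike 𝕜] {n₁ n₂ : ℕ}

theorem rank_eq_finrank_range (X : Matrix (Fin n₁) (Fin n₂) 𝕜) :
    X.rank = Module.finrank 𝕜 (LinearMap.range (Matrix.toEuclideanLin X)) := by
  rw [Matrix.rank_eq_finrank_range_toLin X (EuclideanSpace.basisFun (Fin n₁) 𝕜).toBasis
    (EuclideanSpace.basisFun (Fin n₂) 𝕜).toBasis, Matrix.toEuclideanLin_eq_toLin_orthonormal]

theorem natCast_rank_eq_rank_toEuclideanLin (X : Matrix (Fin n₁) (Fin n₂) 𝕜) :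
    (X.rank : Cardinal) = (Matrix.toEuclideanLin X).rank := by
  rw [rank_eq_finrank_range, Module.finrank_eq_rank]

theorem singularValues_eq_zero_iff_rank_le {X : Matrix (Fin n₁) (Fin n₂) 𝕜} {i : ℕ} :
    (Matrix.toEuclideanLin X).singularValues i = 0 ↔ X.rank ≤ i := by
  rw [LinearMap.singularValues_eq_zero_iff_le_finrank_range, rank_eq_finrank_range]

theorem rank_add_le_rank_add_rank (X Y : Matrix (Fin n₁) (Fin n₂) 𝕜) :
    (X + Y).rank ≤ X.rank + Y.rank := by
  have h := LinearMap.rank_add_le (Matrix.toEuclideanLin X) (Matrix.toEuclideanLin Y)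
  simp only [← map_add, ← natCast_rank_eq_rank_toEuclideanLin] at h
  exact_mod_cast h

theorem rank_sub_le_rank_add_rank (X Y : Matrix (Fin n₁) (Fin n₂) 𝕜) :
    (X - Y).rank ≤ X.rank + Y.rank := by
  have h : (-Y).rank = Y.rank := by
    rw [rank_eq_finrank_range, rank_eq_finrank_range, map_neg, LinearMap.range_neg]
  rw [sub_eq_add_neg, ← h]
  exact rank_add_le_rank_add_rank X (-Y)

theorem rank_sum_outer_le {ι : Type*} (s : Finset ι) (p : ι → EuclideanSpace 𝕜 (Fin n₁))
    (q : ι → EuclideanSpace 𝕜 (Fin n₂)) : (∑ i ∈ s, outer (p i) (q i)).rank ≤ s.card := by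
  classical
  induction s using Finset.induction_on with
  | empty => simp
  | insert i s hi ih =>
    rw [Finset.sum_insert hi, Finset.card_insert_of_notMem hi, add_comm]
    exact (rank_add_le_rank_add_rank _ _).trans
      (add_le_add ih (Matrix.rank_vecMulVec_le _ _))

theorem isClosed_setOf_rank_le (k : ℕ) :
    IsClosed {X : Matrix (Fin n₁) (Fin n₂) 𝕜 | X.rank ≤ k} := by
  have h := (isOpen_setOfPred_nat_le_rank (𝕜 := 𝕜) (E := EuclideanSpace 𝕜 (Fin n₂))
    (F := EuclideanSpace 𝕜 (Fin n₁)) (k + 1)).isClosed_compl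
  let f : Matrix (Fin n₁) (Fin n₂) 𝕜 →ₗ[𝕜]
      EuclideanSpace 𝕜 (Fin n₂) →L[𝕜] EuclideanSpace 𝕜 (Fin n₁) :=
    LinearMap.toContinuousLinearMap.toLinearMap.comp Matrix.toEuclideanLin.toLinearMap
  convert h.preimage f.continuous_of_finiteDimensional using 1
  ext X
  have hf : ((f X : EuclideanSpace 𝕜 (Fin n₂) →L[𝕜] EuclideanSpace 𝕜 (Fin n₁)) :
      EuclideanSpace 𝕜 (Fin n₂) →ₗ[𝕜] EuclideanSpace 𝕜 (Fin n₁)) = Matrix.toEuclideanLin X := rfl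
  simp only [Set.mem_ofPred_eq, Set.mem_preimage, Set.mem_compl_iff, hf,
    ← natCast_rank_eq_rank_toEuclideanLin]
  rw [Nat.cast_le, not_le, Nat.lt_succ_iff]

end Rank

section SVD

variable {𝕜 E F : Type*} [RCLike 𝕜] [NormedAddCommGroup E] [InnerProductSpace 𝕜 E]
  [NormedAddCommGroup F] [InnerProductSpace 𝕜 F]

/-- An orthonormal basis as a sequence of vectors, continued by zeros. -/
def padded {n : ℕ} (b : OrthonormalBasis (Fin n) 𝕜 E) (i : ℕ) : E :=
  if h : i < n then b ⟨i, h⟩ else 0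

/-- If `T bᵢ = σᵢ cᵢ` for the eigenvectors `bᵢ` of `T* T`, then the `cᵢ` with `σᵢ ≠ 0` are
orthonormal, and can be completed to an orthonormal basis. -/
theorem exists_orthonormalBasis_map_padded [FiniteDimensional 𝕜 E] [FiniteDimensional 𝕜 F]
    {m n : ℕ} (hn : Module.finrank 𝕜 E = n) (hm : Module.finrank 𝕜 F = m) (T : E →ₗ[𝕜] F) :
    ∃ (b : OrthonormalBasis (Fin n) 𝕜 E) (c : OrthonormalBasis (Fin m) 𝕜 F),
      ∀ i, T (padded b i) = (T.singularValues i : 𝕜) • padded c i := by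
  have hs := T.isSymmetric_adjoint_comp_self
  set b := hs.eigenvectorBasis hn
  have h_inner : ∀ i j, inner 𝕜 (T (b i)) (T (b j)) =
      if i = j then ((T.singularValues j ^ 2 : ℝ) : 𝕜) else 0 := by
    intro i j
    rw [← LinearMap.adjoint_inner_right, ← LinearMap.comp_apply, hs.apply_eigenvectorBasis,
      inner_smul_right, ← T.sq_singularValues_fin, orthonormal_iff_ite.1 b.orthonormal, mul_ite,
      mul_one, mul_zero]
  have h_lt : ∀ i, T.singularValues i ≠ 0 → i < n ∧ i < m := by
    intro i hi
    rw [Ne, LinearMap.singularValues_eq_zero_iff_le_finrank_range, not_le] at hi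
    exact ⟨hi.trans_le (hn ▸ T.finrank_range_le), hi.trans_le (hm ▸ Submodule.finrank_le _)⟩
  set f : Fin m → F := fun i => (T.singularValues i : 𝕜)⁻¹ • T (padded b i) with hf
  have h_orth : Orthonormal 𝕜 ({i : Fin m | T.singularValues i ≠ 0}.domRestrict f) := by
    rw [orthonormal_iff_ite]
    rintro ⟨i, hi⟩ ⟨j, hj⟩
    have hj' : (T.singularValues j : 𝕜) ≠ 0 := RCLike.ofReal_ne_zero.2 hj
    simp only [Set.domRestrict_apply, hf, padded, (h_lt i hi).1, (h_lt j hj).1, dif_pos,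
      inner_smul_left, inner_smul_right, h_inner, Subtype.mk.injEq, Fin.ext_iff, map_inv₀,
      RCLike.conj_ofReal]
    split_ifs with hij
    · rw [hij, RCLike.ofReal_pow]
      field_simp
    · simp
  obtain ⟨c, hc⟩ := h_orth.exists_orthonormalBasis_extension_of_card_eq (by simpa using hm)
  refine ⟨b, c, fun i => ?_⟩
  by_cases hi : T.singularValues i = 0
  · rw [hi, RCLike.ofReal_zero, zero_smul, padded]
    split_ifs with hin
    · have h := h_inner ⟨i, hin⟩ ⟨i, hin⟩
      rwa [if_pos rfl, hi, sq, mul_zero, RCLike.ofReal_zero, inner_self_eq_zero] at h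
    · exact map_zero T
  · have h := hc ⟨i, (h_lt i hi).2⟩ hi
    rw [padded, padded, dif_pos (h_lt i hi).2, h, hf, smul_inv_smul₀ (RCLike.ofReal_ne_zero.2 hi),
      padded]

variable (𝕜) in
/-- An orthonormal basis, padded by zero vectors; such families make all singular value
decompositions square. -/
structure IsPaddedBasis {ι : Type*} [Fintype ι] (u : ι → E) : Prop where
  orthogonal : ∀ i j, i ≠ j → inner 𝕜 (u i) (u j) = 0
  parseval : ∀ p, ∑ i, ‖inner 𝕜 (u i) p‖ ^ 2 = ‖p‖ ^ 2

theorem isPaddedBasis_padded {n N : ℕ} (hn : n ≤ N) (b : OrthonormalBasis (Fin n) 𝕜 E) :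
    IsPaddedBasis 𝕜 (fun i : Fin N => padded b i) where
  orthogonal i j hij := by
    by_cases hi : (i : ℕ) < n <;> by_cases hj : (j : ℕ) < n <;> simp only [padded, hi, hj, dif_pos,
      dif_neg, not_false_iff, inner_zero_left, inner_zero_right]
    exact b.orthonormal.2 (by simpa [Fin.ext_iff] using hij)
  parseval p := by
    rw [← b.sum_sq_norm_inner_right]
    symm
    apply Finset.sum_of_injOn (Fin.castLE hn) (fun _ _ _ _ h => Fin.castLE_injective hn h)
      (by simp)
    · intro i _ hi
      have : ¬ (i : ℕ) < n := fun h => hi ⟨⟨i, h⟩, by simp, by simp⟩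
      simp [padded, this]
    · intro i _
      simp [padded]

theorem IsPaddedBasis.norm_le_one {ι : Type*} [Fintype ι] {u : ι → E} (hu : IsPaddedBasis 𝕜 u)
    (i : ι) : ‖u i‖ ≤ 1 := by
  have h : ‖inner 𝕜 (u i) (u i)‖ ^ 2 ≤ ‖u i‖ ^ 2 := by
    rw [← hu.parseval (u i)]
    exact Finset.single_le_sum (f := fun j => ‖inner 𝕜 (u j) (u i)‖ ^ 2)
      (fun j _ => by positivity) (Finset.mem_univ i)
  rw [inner_self_eq_norm_sq_to_K, norm_pow, RCLike.norm_ofReal, abs_norm] at h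
  by_contra! hlt
  nlinarith [one_lt_pow₀ hlt two_ne_zero]

variable {n₁ n₂ : ℕ} {ι : Type*} [Fintype ι]

/-- `X = ∑ᵢ xᵢ uᵢ vᵢ*` is a singular value decomposition, the singular values in any order. -/
structure IsSVD (X : Matrix (Fin n₁) (Fin n₂) 𝕜) (u : ι → EuclideanSpace 𝕜 (Fin n₁))
    (v : ι → EuclideanSpace 𝕜 (Fin n₂)) (x : ι → ℝ) : Prop where
  left : IsPaddedBasis 𝕜 u
  right : IsPaddedBasis 𝕜 v
  nonneg : ∀ i, 0 ≤ x i
  norm_left : ∀ i, x i ≠ 0 → ‖u i‖ = 1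
  norm_right : ∀ i, x i ≠ 0 → ‖v i‖ = 1
  eq_sum : X = ∑ i, x i • outer (u i) (v i)

theorem norm_padded {n i : ℕ} (b : OrthonormalBasis (Fin n) 𝕜 E) (hi : i < n) :
    ‖padded b i‖ = 1 := by
  rw [padded, dif_pos hi, b.norm_eq_one]

theorem exists_isSVD (X : Matrix (Fin n₁) (Fin n₂) 𝕜) :
    ∃ (u : Fin (n₁ + n₂) → EuclideanSpace 𝕜 (Fin n₁))
      (v : Fin (n₁ + n₂) → EuclideanSpace 𝕜 (Fin n₂)),
      IsSVD X u v (fun i => (Matrix.toEuclideanLin X).singularValues i) := by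
  obtain ⟨b, c, hT⟩ := exists_orthonormalBasis_map_padded (finrank_euclideanSpace_fin (𝕜 := 𝕜))
    (finrank_euclideanSpace_fin (𝕜 := 𝕜)) (Matrix.toEuclideanLin X)
  have hb := isPaddedBasis_padded (Nat.le_add_left n₂ n₁) b
  refine ⟨fun i => padded c i, fun i => padded b i,
    isPaddedBasis_padded (Nat.le_add_right _ _) c, hb,
    fun i => LinearMap.singularValues_nonneg _ i, fun i hi => norm_padded c ?_,
    fun i hi => norm_padded b ?_, ?_⟩
  · rw [Ne, singularValues_eq_zero_iff_rank_le, not_le] at hi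
    exact hi.trans_le X.rank_le_height
  · rw [Ne, singularValues_eq_zero_iff_rank_le, not_le] at hi
    exact hi.trans_le X.rank_le_width
  · apply Matrix.toEuclideanLin.injective
    refine b.toBasis.ext fun j => ?_
    have hj : padded b j = b j := by rw [padded, dif_pos j.2]
    rw [OrthonormalBasis.coe_toBasis, ← hj, map_sum, LinearMap.sum_apply,
      Finset.sum_eq_single (⟨j, j.2.trans_le (Nat.le_add_left _ _)⟩ : Fin (n₁ + n₂)),
      toEuclideanLin_real_smul, toEuclideanLin_outer, hT]
    · simp [hj]
    · intro i _ hij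
      rw [toEuclideanLin_real_smul, toEuclideanLin_outer,
        hb.orthogonal i ⟨j, j.2.trans_le (Nat.le_add_left _ _)⟩ hij, zero_smul, smul_zero]
    · simp

section

variable {X : Matrix (Fin n₁) (Fin n₂) 𝕜} {u : ι → EuclideanSpace 𝕜 (Fin n₁)}
  {v : ι → EuclideanSpace 𝕜 (Fin n₂)} {x : ι → ℝ}

theorem IsSVD.conjTranspose (hX : IsSVD X u v x) : IsSVD X.conjTranspose v u x where
  left := hX.right
  right := hX.left
  nonneg := hX.nonneg
  norm_left := hX.norm_right
  norm_right := hX.norm_left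
  eq_sum := by
    conv_lhs => rw [hX.eq_sum]
    simp only [Matrix.conjTranspose_sum, Matrix.conjTranspose_smul, star_trivial,
      outer_conjTranspose]

theorem IsSVD.toEuclideanLin_right (hX : IsSVD X u v x) (j : ι) :
    Matrix.toEuclideanLin X (v j) = (x j : 𝕜) • u j := by
  rw [hX.eq_sum, map_sum, LinearMap.sum_apply, Finset.sum_eq_single j,
    toEuclideanLin_real_smul, toEuclideanLin_outer]
  · by_cases hj : x j = 0
    · simp [hj]
    · simp [inner_self_eq_norm_sq_to_K, hX.norm_right j hj]
  · intro i _ hij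
    rw [toEuclideanLin_real_smul, toEuclideanLin_outer, hX.right.orthogonal i j hij, zero_smul,
      smul_zero]
  · simp

theorem IsSVD.inner_sum_smul (hX : IsSVD X u v x) (w : ι → ℝ) :
    inner ℝ (∑ i, w i • outer (u i) (v i)) X = ∑ i, w i * x i := by
  rw [sum_inner]
  refine Finset.sum_congr rfl fun i _ => ?_
  rw [real_inner_smul_left, inner_outer_left, hX.toEuclideanLin_right, inner_smul_right,
    RCLike.re_ofReal_mul, inner_self_eq_norm_sq]
  by_cases h : x i = 0
  · simp [h]
  · simp [hX.norm_left i h]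

theorem IsSVD.norm_sq (hX : IsSVD X u v x) : ‖X‖ ^ 2 = ∑ i, x i ^ 2 := by
  have h := hX.inner_sum_smul x
  rw [← hX.eq_sum, real_inner_self_eq_norm_sq] at h
  simpa only [sq] using h

/-- The residual is that of the orthogonal projection onto the range of `X`. -/
theorem IsSVD.exists_eq_add_toEuclideanLin (hX : IsSVD X u v x) (r : EuclideanSpace 𝕜 (Fin n₁)) :
    ∃ r' z, r = r' + Matrix.toEuclideanLin X z ∧
      ‖r'‖ ^ 2 = ∑ j, if x j = 0 then ‖inner 𝕜 (u j) r‖ ^ 2 else 0 := by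
  set z := ∑ j, ((x j : 𝕜)⁻¹ * inner 𝕜 (u j) r) • v j
  have h_inner : ∀ j, inner 𝕜 (u j) (r - Matrix.toEuclideanLin X z) =
      if x j = 0 then inner 𝕜 (u j) r else 0 := by
    intro j
    rw [inner_sub_right, map_sum, inner_sum, Finset.sum_eq_single j]
    · rw [map_smul, hX.toEuclideanLin_right, inner_smul_right, inner_smul_right]
      split_ifs with hj
      · simp [hj]
      · have hj' : (x j : 𝕜) ≠ 0 := RCLike.ofReal_ne_zero.2 hj
        rw [inner_self_eq_norm_sq_to_K, hX.norm_left j hj]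
        field_simp
        simp
    · intro k _ hkj
      rw [map_smul, hX.toEuclideanLin_right, inner_smul_right, inner_smul_right,
        hX.left.orthogonal j k hkj.symm, mul_zero, mul_zero]
    · simp
  refine ⟨r - Matrix.toEuclideanLin X z, z, (sub_add_cancel _ _).symm, ?_⟩
  rw [← hX.left.parseval]
  refine Finset.sum_congr rfl fun j _ => ?_
  rw [h_inner, apply_ite norm, apply_ite (· ^ 2), norm_zero, zero_pow two_ne_zero]

end

end SVD

section Coupling

variable {𝕜 : Type*} [RCLike 𝕜] {n₁ n₂ : ℕ} {ι κ : Type*} [Fintype ι] [Fintype κ]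

/-- The mean of the squared overlaps of two left and two right singular vectors. Over two singular
value decompositions these weights form a doubly substochastic matrix. -/
def overlap (u p : EuclideanSpace 𝕜 (Fin n₁)) (v q : EuclideanSpace 𝕜 (Fin n₂)) : ℝ :=
  (‖inner 𝕜 u p‖ ^ 2 + ‖inner 𝕜 v q‖ ^ 2) / 2

theorem overlap_nonneg (u p : EuclideanSpace 𝕜 (Fin n₁)) (v q : EuclideanSpace 𝕜 (Fin n₂)) :
    0 ≤ overlap u p v q := by
  unfold overlap; positivity

theorem overlap_comm (u p : EuclideanSpace 𝕜 (Fin n₁)) (v q : EuclideanSpace 𝕜 (Fin n₂)) :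
    overlap u p v q = overlap p u q v := by
  unfold overlap; rw [norm_inner_symm u, norm_inner_symm v]

theorem inner_outer_le_overlap (u p : EuclideanSpace 𝕜 (Fin n₁))
    (v q : EuclideanSpace 𝕜 (Fin n₂)) :
    inner ℝ (outer u v) (outer p q) ≤ overlap u p v q := by
  rw [inner_outer_outer, overlap]
  refine (RCLike.re_le_norm _).trans ?_
  rw [norm_mul, norm_inner_symm q]
  linarith [two_mul_le_add_sq ‖inner 𝕜 u p‖ ‖inner 𝕜 v q‖]

theorem sum_overlap {p : κ → EuclideanSpace 𝕜 (Fin n₁)} {q : κ → EuclideanSpace 𝕜 (Fin n₂)}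
    (hp : IsPaddedBasis 𝕜 p) (hq : IsPaddedBasis 𝕜 q)
    (u : EuclideanSpace 𝕜 (Fin n₁)) (v : EuclideanSpace 𝕜 (Fin n₂)) :
    ∑ j, overlap u (p j) v (q j) = (‖u‖ ^ 2 + ‖v‖ ^ 2) / 2 := by
  simp only [overlap, ← Finset.sum_div, Finset.sum_add_distrib, norm_inner_symm u,
    norm_inner_symm v, hp.parseval, hq.parseval]

variable {X Y : Matrix (Fin n₁) (Fin n₂) 𝕜}
  {u : ι → EuclideanSpace 𝕜 (Fin n₁)} {v : ι → EuclideanSpace 𝕜 (Fin n₂)} {y : ι → ℝ}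
  {p : κ → EuclideanSpace 𝕜 (Fin n₁)} {q : κ → EuclideanSpace 𝕜 (Fin n₂)} {x : κ → ℝ}

theorem sum_overlap_mul_le_left (hY : IsSVD Y u v y) (hX : IsSVD X p q x) {f : ι → ℝ}
    (hf : ∀ i, y i = 0 → 0 ≤ f i) :
    ∑ i, ∑ j, overlap (u i) (p j) (v i) (q j) * f i ≤ ∑ i, f i := by
  refine Finset.sum_le_sum fun i _ => ?_
  rw [← Finset.sum_mul, sum_overlap hX.left hX.right]
  by_cases h : y i = 0
  · have hu := pow_le_one₀ (n := 2) (norm_nonneg _) (hY.left.norm_le_one i)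
    have hv := pow_le_one₀ (n := 2) (norm_nonneg _) (hY.right.norm_le_one i)
    exact mul_le_of_le_one_left (hf i h) (by linarith)
  · simp [hY.norm_left i h, hY.norm_right i h]

/-- Weak duality of optimal transport, for the coupling given by the overlaps. -/
theorem sum_overlap_mul_le (hY : IsSVD Y u v y) (hX : IsSVD X p q x) {C : ι → κ → ℝ} {f : ι → ℝ}
    {g : κ → ℝ} (hC : ∀ i j, C i j ≤ f i + g j) (hf : ∀ i, y i = 0 → 0 ≤ f i)
    (hg : ∀ j, x j = 0 → 0 ≤ g j) :
    ∑ i, ∑ j, overlap (u i) (p j) (v i) (q j) * C i j ≤ ∑ i, f i + ∑ j, g j :=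
  calc ∑ i, ∑ j, overlap (u i) (p j) (v i) (q j) * C i j
      ≤ ∑ i, ∑ j, overlap (u i) (p j) (v i) (q j) * (f i + g j) := by
        gcongr with i _ j _
        · exact overlap_nonneg _ _ _ _
        · exact hC i j
    _ = ∑ i, ∑ j, overlap (u i) (p j) (v i) (q j) * f i +
        ∑ j, ∑ i, overlap (p j) (u i) (q j) (v i) * g j := by
        rw [Finset.sum_comm (s := Finset.univ (α := κ))]
        simp only [mul_add, Finset.sum_add_distrib, overlap_comm (u _)]
    _ ≤ ∑ i, f i + ∑ j, g j :=
        add_le_add (sum_overlap_mul_le_left hY hX hf) (sum_overlap_mul_le_left hX hY hg)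

theorem inner_sum_smul_le_sum_overlap (hX : IsSVD X p q x) {w : ι → ℝ} (hw : ∀ i, 0 ≤ w i) :
    inner ℝ (∑ i, w i • outer (u i) (v i)) X ≤
      ∑ i, ∑ j, overlap (u i) (p j) (v i) (q j) * (w i * x j) := by
  conv_lhs => rw [hX.eq_sum]
  simp only [sum_inner, inner_sum, real_inner_smul_left, real_inner_smul_right]
  rw [Finset.sum_comm]
  refine Finset.sum_le_sum fun i _ => Finset.sum_le_sum fun j _ => ?_
  linarith [mul_le_mul_of_nonneg_right (inner_outer_le_overlap (u i) (p j) (v i) (q j))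
    (mul_nonneg (hw i) (hX.nonneg j))]

/-- `2 ∑ᵢ max(√μ, yᵢ) uᵢ vᵢ*` is a subgradient at `Y` of the convex function
`X ↦ ‖X‖² + ∑ᵢ r_μ(σᵢ(X))`. -/
theorem norm_sq_add_sum_rMu_subgradient {μ : ℝ} (hμ : 0 ≤ μ) (hY : IsSVD Y u v y)
    (hX : IsSVD X p q x) :
    ‖Y‖ ^ 2 + ∑ i, rMu μ (y i) +
        2 * inner ℝ (∑ i, max (√μ) (y i) • outer (u i) (v i)) (X - Y) ≤
      ‖X‖ ^ 2 + ∑ j, rMu μ (x j) := by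
  have h_inner : inner ℝ (∑ i, max (√μ) (y i) • outer (u i) (v i)) X ≤
      ∑ i, (max (√μ) (y i) * y i - (y i ^ 2 + rMu μ (y i)) / 2) +
        ∑ j, (x j ^ 2 + rMu μ (x j)) / 2 := by
    refine (inner_sum_smul_le_sum_overlap hX fun i => ?_).trans
      (sum_overlap_mul_le hY hX (fun i j => ?_) (fun i hi => ?_) (fun j hj => ?_))
    · exact (Real.sqrt_nonneg μ).trans (le_max_left _ _)
    · linarith [sq_add_rMu_subgradient (x := x j) (y := y i) hμ]
    · simp [hi, rMu_zero hμ]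
    · simp [hj, rMu_zero hμ]
  rw [Finset.sum_sub_distrib, ← Finset.sum_div, ← Finset.sum_div, Finset.sum_add_distrib,
    Finset.sum_add_distrib, ← hY.norm_sq, ← hX.norm_sq, ← hY.inner_sum_smul] at h_inner
  rw [inner_sub_right]
  linarith

/-- For `β = 0` an Eckart–Young bound, and for `S.card = R.card + 1` Weyl's perturbation bound. -/
theorem card_sub_card_mul_sq_le_norm_sub_sq (hY : IsSVD Y u v y) (hX : IsSVD X p q x) {α β : ℝ}
    (hβ : 0 ≤ β) (hβα : β ≤ α) {S : Finset κ} (hS : ∀ j ∈ S, α ≤ x j) {R : Finset ι}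
    (hR : ∀ i ∉ R, y i ≤ β) :
    ((S.card : ℝ) - R.card) * (α - β) ^ 2 ≤ ‖Y - X‖ ^ 2 := by
  classical
  set d := (α - β) ^ 2 / 2 with hd
  have hd0 : 0 ≤ d := by positivity
  have h_inner : inner ℝ Y X ≤
      ∑ i, (y i ^ 2 / 2 + if i ∈ R then d else 0) +
        ∑ j, (x j ^ 2 / 2 - if j ∈ S then d else 0) := by
    conv_lhs => rw [hY.eq_sum]
    refine (inner_sum_smul_le_sum_overlap hX hY.nonneg).trans
      (sum_overlap_mul_le hY hX (fun i j => ?_) (fun i _ => ?_) (fun j hj => ?_))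
    · have h_sq : y i * x j ≤ y i ^ 2 / 2 + x j ^ 2 / 2 := by
        linarith [two_mul_le_add_sq (y i) (x j)]
      split_ifs with hi hj hj
      · linarith
      · linarith
      · have := pow_le_pow_left₀ (sub_nonneg.2 hβα) (sub_le_sub (hS j hj) (hR i hi)) 2
        linarith
      · linarith
    · split_ifs <;> positivity
    · split_ifs with hjS
      · have hα : α ≤ 0 := hj ▸ hS j hjS
        have hαβ : α = β := by linarith
        simp [hj, hd, hαβ]
      · simp [hj]
  rw [Finset.sum_add_distrib, Finset.sum_sub_distrib, ← Finset.sum_div, ← Finset.sum_div,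
    ← hY.norm_sq, ← hX.norm_sq, Finset.sum_ite_mem, Finset.sum_ite_mem, Finset.univ_inter,
    Finset.univ_inter, Finset.sum_const, Finset.sum_const, nsmul_eq_mul, nsmul_eq_mul] at h_inner
  have h_two_d : (α - β) ^ 2 = 2 * d := by rw [hd, mul_div_cancel₀ _ two_ne_zero]
  rw [norm_sub_sq_real, h_two_d]
  linarith

theorem sub_mul_singularValues_sub_sq_le (X Y : Matrix (Fin n₁) (Fin n₂) 𝕜) {k m : ℕ}
    (h : (Matrix.toEuclideanLin Y).singularValues m ≤ (Matrix.toEuclideanLin X).singularValues k) :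
    ((k + 1 : ℝ) - m) * ((Matrix.toEuclideanLin X).singularValues k -
      (Matrix.toEuclideanLin Y).singularValues m) ^ 2 ≤ ‖Y - X‖ ^ 2 := by
  obtain ⟨u, v, hY⟩ := exists_isSVD Y
  obtain ⟨p, q, hX⟩ := exists_isSVD X
  rcases le_or_gt (n₁ + n₂) k with hk | hk
  · have hXk : (Matrix.toEuclideanLin X).singularValues k = 0 :=
      singularValues_eq_zero_iff_rank_le.2 (X.rank_le_height.trans (by omega))
    have hYm := h.antisymm' (hXk.trans_le (LinearMap.singularValues_nonneg _ _))
    rw [hYm, sub_self, zero_pow two_ne_zero, mul_zero]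
    positivity
  · have h_card := card_sub_card_mul_sq_le_norm_sub_sq hY hX
      (LinearMap.singularValues_nonneg _ m) h
      (S := Finset.univ.filter fun j : Fin (n₁ + n₂) => (j : ℕ) < k + 1)
      (R := Finset.univ.filter fun i : Fin (n₁ + n₂) => (i : ℕ) < m)
      (fun j hj => LinearMap.singularValues_antitone _
        (Nat.lt_succ_iff.1 (Finset.mem_filter.1 hj).2))
      (fun i hi => LinearMap.singularValues_antitone _ (by simpa using hi))
    refine le_trans ?_ h_card
    rw [Fin.card_filter_val_lt, Fin.card_filter_val_lt, min_eq_right (Nat.succ_le_of_lt hk)]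
    push_cast
    gcongr
    exact min_le_right _ _

theorem singularValues_le_norm_sub_add (X Y : Matrix (Fin n₁) (Fin n₂) 𝕜) (k : ℕ) :
    (Matrix.toEuclideanLin X).singularValues k ≤
      ‖Y - X‖ + (Matrix.toEuclideanLin Y).singularValues k := by
  rcases le_total ((Matrix.toEuclideanLin X).singularValues k)
    ((Matrix.toEuclideanLin Y).singularValues k) with h | h
  · exact h.trans (le_add_of_nonneg_left (norm_nonneg _))
  · have h_sq := sub_mul_singularValues_sub_sq_le X Y h
    rw [add_sub_cancel_left, one_mul] at h_sq
    exact sub_le_iff_le_add.1 (abs_le_of_sq_le_sq' h_sq (norm_nonneg _)).2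

theorem le_sum_overlap_of_forall_mul_eq_zero (hX : IsSVD X p q x)
    {ℓ : Matrix (Fin n₁) (Fin n₂) 𝕜 →ₗ[ℝ] ℝ} {e : ℝ} (he : 0 ≤ e)
    (hℓ : ∀ r s, ℓ (outer r s) ≤ e * (‖r‖ * ‖s‖))
    (hl : ∀ Z : Matrix (Fin n₂) (Fin n₂) 𝕜, ℓ (X * Z) = 0)
    (hr : ∀ Z : Matrix (Fin n₁) (Fin n₁) 𝕜, ℓ (Z * X) = 0)
    (r : EuclideanSpace 𝕜 (Fin n₁)) (s : EuclideanSpace 𝕜 (Fin n₂)) :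
    ℓ (outer r s) ≤ ∑ j, overlap r (p j) s (q j) * (if x j = 0 then e else 0) := by
  obtain ⟨r', z, h_left, hr'⟩ := hX.exists_eq_add_toEuclideanLin r
  obtain ⟨s', z', h_right, hs'⟩ := hX.conjTranspose.exists_eq_add_toEuclideanLin s
  have h_residual : ℓ (outer r s) = ℓ (outer r' s') := by
    rw [h_left, outer_add_left, ← mul_outer, map_add, hl, add_zero, h_right, outer_add_right,
      ← outer_mul, map_add, hr, add_zero]
  calc ℓ (outer r s) ≤ e * (‖r'‖ * ‖s'‖) := h_residual ▸ hℓ r' s'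
    _ ≤ e * ((‖r'‖ ^ 2 + ‖s'‖ ^ 2) / 2) := by
        gcongr
        linarith [two_mul_le_add_sq ‖r'‖ ‖s'‖]
    _ = _ := by
        rw [hr', hs', ← Finset.sum_add_distrib, Finset.sum_div, Finset.mul_sum]
        refine Finset.sum_congr rfl fun j _ => ?_
        split_ifs
        · rw [overlap, norm_inner_symm r, norm_inner_symm s, mul_comm]
        · simp

/-- Strong monotonicity of the subgradients of `‖·‖² / 2 + ∑ᵢ r_μ(σᵢ(·)) / 2` around `X`, where
`X + E`, with `E` representing `ℓ`, is a subgradient whose singular values avoid a neighbourhood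
of `√μ`. -/
theorem strong_monotone_of_gap {μ γ e : ℝ} (hμ : 0 < μ) (hγ : 0 < γ) (hγ1 : γ < 1)
    (he : 0 ≤ e) (heγ : e ≤ γ * √μ) (hY : IsSVD Y u v y) (hX : IsSVD X p q x)
    (hgap : ∀ j, x j = 0 ∨ √μ ≤ γ * x j) {ℓ : Matrix (Fin n₁) (Fin n₂) 𝕜 →ₗ[ℝ] ℝ}
    (hℓ : ∀ r s, ℓ (outer r s) ≤ e * (‖r‖ * ‖s‖))
    (hl : ∀ Z : Matrix (Fin n₂) (Fin n₂) 𝕜, ℓ (X * Z) = 0)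
    (hr : ∀ Z : Matrix (Fin n₁) (Fin n₁) 𝕜, ℓ (Z * X) = 0) :
    (1 - γ) * ‖Y - X‖ ^ 2 ≤
      inner ℝ (∑ i, max (√μ) (y i) • outer (u i) (v i) - X) (Y - X) - ℓ (Y - X) := by
  set W := ∑ i, max (√μ) (y i) • outer (u i) (v i) with hW
  have hℓX : ℓ X = 0 := by simpa using hl 1
  have hℓY : ℓ Y ≤ ∑ i, ∑ j, overlap (u i) (p j) (v i) (q j) *
      ((if x j = 0 then e else 0) * y i) := by
    rw [hY.eq_sum, map_sum]
    refine Finset.sum_le_sum fun i _ => ?_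
    rw [map_smul, smul_eq_mul, mul_comm]
    simp only [← mul_assoc, ← Finset.sum_mul]
    exact mul_le_mul_of_nonneg_right
      (le_sum_overlap_of_forall_mul_eq_zero hX he hℓ hl hr (u i) (v i)) (hY.nonneg i)
  have h_inner : inner ℝ (W - (1 - 2 * γ) • Y) X ≤ ∑ i, ∑ j,
      overlap (u i) (p j) (v i) (q j) * ((max (√μ) (y i) - (1 - 2 * γ) * y i) * x j) := by
    have h_eq : W - (1 - 2 * γ) • Y =
        ∑ i, (max (√μ) (y i) - (1 - 2 * γ) * y i) • outer (u i) (v i) := by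
      simp only [sub_smul, mul_smul, Finset.sum_sub_distrib, ← Finset.smul_sum, ← hY.eq_sum, hW]
    rw [h_eq]
    refine inner_sum_smul_le_sum_overlap hX fun i => ?_
    nlinarith [le_max_right (√μ) (y i), mul_nonneg hγ.le (hY.nonneg i)]
  have h_transport := sum_overlap_mul_le hY hX
    (f := fun i => max (√μ) (y i) * y i - (1 - γ) * y i ^ 2) (g := fun j => γ * x j ^ 2)
    (fun i j => max_sub_mul_add_ite_mul_le hγ hγ1 (Real.sqrt_pos.2 hμ) (hY.nonneg i) heγ (hgap j))
    (fun i hi => by simp [hi]) (fun j hj => by simp [hj])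
  simp only [mul_add, Finset.sum_add_distrib, Finset.sum_sub_distrib, ← Finset.mul_sum,
    ← hX.norm_sq, ← hY.norm_sq, ← hY.inner_sum_smul, ← hW] at h_transport
  rw [inner_sub_left, real_inner_smul_left] at h_inner
  rw [map_sub, hℓX, norm_sub_sq_real, inner_sub_left, inner_sub_right, inner_sub_right,
    real_inner_self_eq_norm_sq, real_inner_comm Y X]
  linarith

end Coupling

section Relaxation

variable {F : Type*} [NormedAddCommGroup F] [InnerProductSpace ℝ F] {ι : Type*} [Fintype ι]

/-- `∑ᵢ r_μ(xᵢ) + ‖∑ᵢ xᵢ wᵢ - b‖²`: the regularized functional as a function of the singular values,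
with the singular vectors held fixed. -/
def regLeastSquares (w : ι → F) (b : F) (μ : ℝ) (x : ι → ℝ) : ℝ :=
  ∑ i, rMu μ (x i) + ‖∑ i, x i • w i - b‖ ^ 2

/-- Since `‖w‖ < 1`, the functional is strictly concave in `s` on `[0, √μ]`. -/
theorem exists_rMu_add_norm_sq_lt {μ s : ℝ} {w : F} (hw : ‖w‖ < 1) (z : F)
    (hs : 0 < s) (hsμ : s < √μ) :
    ∃ t, (t = 0 ∨ t = √μ) ∧ rMu μ t + ‖t • w + z‖ ^ 2 < rMu μ s + ‖s • w + z‖ ^ 2 := by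
  have h_expand : ∀ t ≤ √μ, rMu μ t + ‖t • w + z‖ ^ 2 =
      ‖z‖ ^ 2 + 2 * (√μ + inner ℝ w z) * t - (1 - ‖w‖ ^ 2) * t ^ 2 := fun t ht => by
    rw [rMu_of_le_sqrt (Real.sqrt_pos.1 (hs.trans hsμ)).le ht, norm_add_sq_real,
      real_inner_smul_left, norm_smul, mul_pow, Real.norm_eq_abs, sq_abs]
    ring
  have h_concave : 0 < 1 - ‖w‖ ^ 2 := sub_pos.2 (pow_lt_one₀ (norm_nonneg w) hw two_ne_zero)
  rcases lt_or_ge ((1 - ‖w‖ ^ 2) * s) (2 * (√μ + inner ℝ w z)) with h | h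
  · refine ⟨0, .inl rfl, ?_⟩
    rw [h_expand 0 (Real.sqrt_nonneg μ), h_expand s hsμ.le]
    linarith [mul_lt_mul_of_pos_right h hs]
  · refine ⟨√μ, .inr rfl, ?_⟩
    rw [h_expand _ le_rfl, h_expand s hsμ.le]
    have h_slope : 0 < (√μ - s) * ((1 - ‖w‖ ^ 2) * (√μ + s) - 2 * (√μ + inner ℝ w z)) :=
      mul_pos (sub_pos.2 hsμ) (by linarith [mul_pos h_concave (hs.trans hsμ)])
    linarith

theorem exists_regLeastSquares_update_lt [DecidableEq ι] {w : ι → F} {b : F} {μ : ℝ}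
    {x : ι → ℝ} {i : ι} (hw : ‖w i‖ < 1) (h0 : 0 < x i) (h1 : x i < √μ) :
    ∃ t, (t = 0 ∨ t = √μ) ∧
      regLeastSquares w b μ (Function.update x i t) < regLeastSquares w b μ x := by
  have h_split : ∀ t, regLeastSquares w b μ (Function.update x i t) =
      (rMu μ t + ‖t • w i + (∑ j ∈ Finset.univ \ {i}, x j • w j - b)‖ ^ 2) +
        ∑ j ∈ Finset.univ \ {i}, rMu μ (x j) := fun t => by
    rw [regLeastSquares, ← Finset.sum_sdiff (Finset.subset_univ {i}),
      ← Finset.sum_sdiff (Finset.subset_univ {i}) (f := fun j => _ • w j), Finset.sum_singleton,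
      Finset.sum_singleton, Function.update_self]
    have h_off : ∀ j ∈ Finset.univ \ {i}, Function.update x i t j = x j := fun j hj =>
      Function.update_of_ne (by simpa using hj) _ _
    rw [Finset.sum_congr rfl fun j hj => congrArg (rMu μ) (h_off j hj),
      Finset.sum_congr rfl fun j hj => congrArg (· • w j) (h_off j hj), add_comm (∑ j ∈ _, _ • _),
      add_sub_assoc]
    ring
  obtain ⟨t, ht, hlt⟩ := exists_rMu_add_norm_sq_lt hw
    (∑ j ∈ Finset.univ \ {i}, x j • w j - b) h0 h1
  refine ⟨t, ht, ?_⟩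
  rw [h_split, ← Function.update_eq_self i x, h_split, Function.update_eq_self]
  linarith

theorem exists_regLeastSquares_le {w : ι → F} (hw : ∀ i, ‖w i‖ < 1) (b : F) (μ : ℝ)
    {x : ι → ℝ} (hx : ∀ i, 0 ≤ x i) :
    ∃ y : ι → ℝ, (∀ i, y i = 0 ∨ √μ ≤ y i) ∧
      (y = x ∨ regLeastSquares w b μ y < regLeastSquares w b μ x) := by
  classical
  let grid := Fintype.piFinset fun i => ({x i, 0, √μ} : Finset ℝ)
  have h_grid : ∀ y, y ∈ grid ↔ ∀ i, y i = x i ∨ y i = 0 ∨ y i = √μ := by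
    simp [grid, Fintype.mem_piFinset]
  have h_thresholded : ∀ y ∈ grid, (∀ z ∈ grid, regLeastSquares w b μ y ≤ regLeastSquares w b μ z) →
      ∀ i, y i = 0 ∨ √μ ≤ y i := by
    intro y hy hmin i
    by_contra! h
    have h0 : 0 < y i := by
      rcases (h_grid y).1 hy i with hi | hi | hi
      · exact (hi ▸ hx i).lt_of_ne' h.1
      · exact absurd hi h.1
      · exact absurd hi h.2.ne
    obtain ⟨t, ht, hlt⟩ := exists_regLeastSquares_update_lt (b := b) (hw i) h0 h.2
    refine hlt.not_ge (hmin _ ((h_grid _).2 fun j => ?_))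
    rcases eq_or_ne j i with rfl | hj
    · rw [Function.update_self]; exact .inr ht
    · rw [Function.update_of_ne hj]; exact (h_grid y).1 hy j
  have hx_mem : x ∈ grid := (h_grid x).2 fun i => .inl rfl
  obtain ⟨y, hy, hmin⟩ := grid.exists_min_image (regLeastSquares w b μ) ⟨x, hx_mem⟩
  rcases (hmin x hx_mem).lt_or_eq with h | h
  · exact ⟨y, h_thresholded y hy hmin, .inr h⟩
  · exact ⟨x, h_thresholded x hx_mem fun z hz => h ▸ hmin z hz, .inl rfl⟩

variable {𝕜 : Type*} [RCLike 𝕜] {n₁ n₂ : ℕ} {A : Matrix (Fin n₁) (Fin n₂) 𝕜 →ₗ[ℝ] F} {b : F} {μ : ℝ}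

theorem regFunctional_eq (hμ : 0 ≤ μ) (X : Matrix (Fin n₁) (Fin n₂) 𝕜) :
    regFunctional A b μ X = ∑ i : Fin (n₁ + n₂), rMu μ ((Matrix.toEuclideanLin X).singularValues i)
      + ‖A X - b‖ ^ 2 := by
  rw [regFunctional]
  congr 1
  rw [Fin.sum_univ_eq_sum_range (fun i => rMu μ ((Matrix.toEuclideanLin X).singularValues i)),
    Finset.range_eq_Ico, ← Finset.sum_subset (s₁ := Finset.Ico 0 (min n₁ n₂))
      (s₂ := Finset.Ico 0 (n₁ + n₂))]
  · rw [← Finset.Ico_add_one_right_eq_Icc, ← zero_add 1, ← Finset.sum_Ico_add']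
    rfl
  · exact Finset.Ico_subset_Ico_right (by omega)
  · intro i _ hi
    have h_rank : X.rank ≤ i :=
      (le_min X.rank_le_height X.rank_le_width).trans
        (not_lt.1 fun h => hi (Finset.mem_Ico.2 ⟨i.zero_le, h⟩))
    rw [singularValues_eq_zero_iff_rank_le.2 h_rank, rMu_zero hμ]

theorem regFunctional_le_rankFunctional (hμ : 0 ≤ μ) (X : Matrix (Fin n₁) (Fin n₂) 𝕜) :
    regFunctional A b μ X ≤ rankFunctional A b μ X := by
  have h_card : (Finset.univ.filter fun i : Fin (n₁ + n₂) =>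
      (Matrix.toEuclideanLin X).singularValues i ≠ 0).card = X.rank := by
    simp only [Ne, singularValues_eq_zero_iff_rank_le, not_le]
    rw [Fin.card_filter_val_lt, min_eq_right (X.rank_le_height.trans (Nat.le_add_right _ _))]
  rw [regFunctional_eq hμ, rankFunctional, ← h_card, mul_comm, ← nsmul_eq_mul, ← Finset.sum_const,
    Finset.sum_filter]
  gcongr with i _
  split_ifs with h
  · exact rMu_le _ _
  · rw [not_not.1 h, rMu_zero hμ]

theorem rankFunctional_sum_outer_le {p : ι → EuclideanSpace 𝕜 (Fin n₁)}
    {q : ι → EuclideanSpace 𝕜 (Fin n₂)} {y : ι → ℝ} (hμ : 0 ≤ μ)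
    (hy : ∀ i, y i = 0 ∨ √μ ≤ y i) :
    rankFunctional A b μ (∑ i, y i • outer (p i) (q i)) ≤
      regLeastSquares (fun i => A (outer (p i) (q i))) b μ y := by
  have h_rank : (∑ i, y i • outer (p i) (q i)).rank ≤ (Finset.univ.filter (y · ≠ 0)).card := by
    rw [← Finset.sum_filter_of_ne (p := (y · ≠ 0)) fun i _ => by simp_all]
    simp only [real_smul_outer]
    exact rank_sum_outer_le _ _ _
  have h_sum : ∑ i, rMu μ (y i) = μ * (Finset.univ.filter (y · ≠ 0)).card := by
    rw [mul_comm, ← nsmul_eq_mul, ← Finset.sum_const, Finset.sum_filter]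
    refine Finset.sum_congr rfl fun i _ => ?_
    split_ifs with h
    · exact rMu_of_sqrt_le ((hy i).resolve_left h)
    · rw [not_not.1 h, rMu_zero hμ]
  rw [rankFunctional, regLeastSquares, h_sum, map_sum]
  simp only [map_smul]
  gcongr

theorem rankFunctional_le_regFunctional_or_exists_lt (hμ : 0 ≤ μ)
    (hA : ∀ X : Matrix (Fin n₁) (Fin n₂) 𝕜, ‖X‖ ≤ 1 → ‖A X‖ < 1)
    (X : Matrix (Fin n₁) (Fin n₂) 𝕜) :
    rankFunctional A b μ X ≤ regFunctional A b μ X ∨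
      ∃ Y, rankFunctional A b μ Y < regFunctional A b μ X := by
  obtain ⟨u, v, hX⟩ := exists_isSVD X
  have hw : ∀ i, ‖A (outer (u i) (v i))‖ < 1 := fun i => hA _ <| by
    rw [norm_outer]
    exact mul_le_one₀ (hX.left.norm_le_one i) (norm_nonneg _) (hX.right.norm_le_one i)
  obtain ⟨y, hy, hyX⟩ := exists_regLeastSquares_le hw b μ hX.nonneg
  have h_reg : regFunctional A b μ X = regLeastSquares (fun i => A (outer (u i) (v i))) b μ
      fun i => (Matrix.toEuclideanLin X).singularValues i := by
    simp only [regFunctional_eq hμ, regLeastSquares, ← map_smul, ← map_sum, ← hX.eq_sum]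
  have h_rank := rankFunctional_sum_outer_le (A := A) (b := b) (p := u) (q := v) hμ hy
  rcases hyX with rfl | hlt
  · exact .inl (by rwa [← hX.eq_sum, ← h_reg] at h_rank)
  · exact .inr ⟨_, h_rank.trans_lt (h_reg ▸ hlt)⟩

theorem globalMinimizers_regFunctional (hμ : 0 ≤ μ)
    (hA : ∀ X : Matrix (Fin n₁) (Fin n₂) 𝕜, ‖X‖ ≤ 1 → ‖A X‖ < 1) :
    globalMinimizers (regFunctional A b μ) = globalMinimizers (rankFunctional A b μ) := by
  have h_le := regFunctional_le_rankFunctional (A := A) (b := b) hμ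
  have h_or := rankFunctional_le_regFunctional_or_exists_lt (b := b) hμ hA
  ext X
  refine ⟨fun hX Y => ?_, fun hX Y => ?_⟩
  · refine le_trans ?_ ((hX Y).trans (h_le Y))
    rcases h_or X with h | ⟨Z, h⟩
    · exact h
    · exact absurd (h.trans_le ((hX Z).trans (h_le Z))) (lt_irrefl _)
  · refine (h_le X).trans ?_
    rcases h_or Y with h | ⟨Z, h⟩
    · exact (hX Y).trans h
    · exact (hX Z).trans h.le

end Relaxation

section StationaryPoints

theorem IsStationaryPt.eventually_lt {E : Type*} [NormedAddCommGroup E] [NormedSpace ℝ E]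
    {g : E → ℝ} {X : E} (hX : IsStationaryPt g X) {η : ℝ} (hη : 0 < η) (D : E) :
    ∀ᶠ t : ℝ in 𝓝[>] 0, g X - η * t < g (X + t • D) := by
  rcases eq_or_ne D 0 with rfl | hD
  · filter_upwards [self_mem_nhdsWithin] with t ht
    rw [smul_zero, add_zero]
    exact sub_lt_self _ (mul_pos hη ht)
  have hD_pos : 0 < ‖D‖ := norm_pos_iff.2 hD
  have h_slope : ∀ᶠ Y in 𝓝[≠] X, -(η / ‖D‖) < (g Y - g X) / ‖Y - X‖ :=
    (eventually_lt_of_lt_liminf (lt_of_lt_of_le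
      (EReal.coe_lt_coe_iff.2 (neg_lt_zero.2 (div_pos hη hD_pos))) hX)).mono
        fun _ => EReal.coe_lt_coe_iff.1
  have h_line : Tendsto (fun t : ℝ => X + t • D) (𝓝[>] 0) (𝓝[≠] X) := by
    refine tendsto_nhdsWithin_iff.2 ⟨?_, ?_⟩
    · have h : Continuous fun t : ℝ => X + t • D := by fun_prop
      exact (h.tendsto' 0 X (by simp)).mono_left nhdsWithin_le_nhds
    · filter_upwards [self_mem_nhdsWithin] with t ht
      simpa [hD] using (Set.mem_Ioi.1 ht).ne'
  filter_upwards [h_line.eventually h_slope, self_mem_nhdsWithin] with t h ht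
  have ht : 0 < t := ht
  rw [add_sub_cancel_left, norm_smul, Real.norm_of_nonneg ht.le, lt_div_iff₀ (mul_pos ht hD_pos),
    neg_mul, mul_left_comm, div_mul_cancel₀ _ hD_pos.ne'] at h
  linarith

theorem isStationaryPt_of_mem_globalMinimizers {E : Type*} [NormedAddCommGroup E] {g : E → ℝ}
    {X : E} (h : X ∈ globalMinimizers g) : IsStationaryPt g X := by
  refine le_liminf_of_le (by isBoundedDefault) (Eventually.of_forall fun Y => ?_)
  exact_mod_cast div_nonneg (sub_nonneg.2 (h Y)) (norm_nonneg _)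

variable {𝕜 : Type*} [RCLike 𝕜] {n₁ n₂ : ℕ}
  {F : Type*} [NormedAddCommGroup F] [InnerProductSpace ℝ F]
  {A : Matrix (Fin n₁) (Fin n₂) 𝕜 →ₗ[ℝ] F} {b : F} {μ γ : ℝ} {B : Matrix (Fin n₁) (Fin n₂) 𝕜}

/-- `B` satisfies the normal equations of `‖A X - b‖` in the directions `B Z` and `Z B`, and the
singular values of the subgradient `B + A* (b - A B)` avoid `(γ √μ, √μ / γ)`. The latter is encoded
by a bound on `b - A B`, for `‖A‖ ≤ 1`, and one on the non-zero singular values of `B`. -/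
structure HasSpectralGap (A : Matrix (Fin n₁) (Fin n₂) 𝕜 →ₗ[ℝ] F) (b : F) (μ γ : ℝ)
    (B : Matrix (Fin n₁) (Fin n₂) 𝕜) : Prop where
  norm_residual_le : ‖b - A B‖ ≤ γ * √μ
  eq_zero_or_le : ∀ j, (Matrix.toEuclideanLin B).singularValues j = 0 ∨
    √μ ≤ γ * (Matrix.toEuclideanLin B).singularValues j
  inner_map_mul_right : ∀ Z : Matrix (Fin n₂) (Fin n₂) 𝕜, inner ℝ (b - A B) (A (B * Z)) = 0
  inner_map_mul_left : ∀ Z : Matrix (Fin n₁) (Fin n₁) 𝕜, inner ℝ (b - A B) (A (Z * B)) = 0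

theorem HasSpectralGap.strong_monotone (hB : HasSpectralGap A b μ γ B) (hμ : 0 < μ)
    (hA : ∀ X, ‖A X‖ ≤ ‖X‖) (hγ : 0 < γ) (hγ1 : γ < 1) {ι : Type*} [Fintype ι]
    {Y : Matrix (Fin n₁) (Fin n₂) 𝕜} {u : ι → EuclideanSpace 𝕜 (Fin n₁)}
    {v : ι → EuclideanSpace 𝕜 (Fin n₂)} {y : ι → ℝ} (hY : IsSVD Y u v y) :
    (1 - γ) * ‖Y - B‖ ^ 2 ≤ inner ℝ (∑ i, max (√μ) (y i) • outer (u i) (v i) - B) (Y - B) -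
      inner ℝ (b - A B) (A (Y - B)) := by
  obtain ⟨p, q, hp⟩ := exists_isSVD B
  refine strong_monotone_of_gap hμ hγ hγ1 (norm_nonneg _) hB.norm_residual_le hY hp
    (fun j => hB.eq_zero_or_le j) (ℓ := (innerₛₗ ℝ (b - A B)).comp A) (fun r s => ?_)
    hB.inner_map_mul_right hB.inner_map_mul_left
  rw [← norm_outer]
  exact (real_inner_le_norm _ _).trans (mul_le_mul_of_nonneg_left (hA _) (norm_nonneg _))

theorem HasSpectralGap.regFunctional_add_smul_le (hB : HasSpectralGap A b μ γ B) (hμ : 0 < μ)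
    (hA : ∀ X, ‖A X‖ ≤ ‖X‖) (hγ : 0 < γ) (hγ1 : γ < 1) (X : Matrix (Fin n₁) (Fin n₂) 𝕜) {t : ℝ}
    (ht0 : 0 ≤ t) (ht1 : t < 1) :
    regFunctional A b μ (X + t • (B - X)) ≤
      regFunctional A b μ X - 2 * t * (‖A (X - B)‖ ^ 2 - (γ + t) * ‖X - B‖ ^ 2) := by
  obtain ⟨D, rfl⟩ : ∃ D, X = B + D := ⟨X - B, (add_sub_cancel B X).symm⟩
  obtain ⟨u, v, hY⟩ := exists_isSVD (B + (1 - t) • D)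
  obtain ⟨u', v', hX⟩ := exists_isSVD (B + D)
  have h_sub := norm_sq_add_sum_rMu_subgradient hμ.le hY hX
  have h_mono := hB.strong_monotone hμ hA hγ hγ1 hY
  set W := ∑ i : Fin (n₁ + n₂), max (√μ)
    ((Matrix.toEuclideanLin (B + (1 - t) • D)).singularValues i) • outer (u i) (v i)
  have h_mono_D : (1 - γ) * (1 - t) * ‖D‖ ^ 2 ≤ inner ℝ (W - B) D - inner ℝ (b - A B) (A D) := by
    rw [add_sub_cancel_left, norm_smul, map_smul, real_inner_smul_right, real_inner_smul_right,
      mul_pow, Real.norm_eq_abs, sq_abs] at h_mono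
    refine le_of_mul_le_mul_left ?_ (sub_pos.2 ht1)
    linarith
  have h_norm (s : ℝ) : ‖B + s • D‖ ^ 2 = ‖B‖ ^ 2 + 2 * s * inner ℝ B D + s ^ 2 * ‖D‖ ^ 2 := by
    rw [norm_add_sq_real, real_inner_smul_right, norm_smul, mul_pow, Real.norm_eq_abs, sq_abs]
    ring
  have h_res (s : ℝ) : ‖A (B + s • D) - b‖ ^ 2 =
      ‖b - A B‖ ^ 2 - 2 * s * inner ℝ (b - A B) (A D) + s ^ 2 * ‖A D‖ ^ 2 := by
    rw [norm_sub_rev, map_add, map_smul, ← sub_sub, norm_sub_sq_real, real_inner_smul_right,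
      norm_smul, mul_pow, Real.norm_eq_abs, sq_abs]
    ring
  have h_norm_X := h_norm 1
  have h_res_X := h_res 1
  rw [one_smul] at h_norm_X h_res_X
  have hAD : ‖A D‖ ^ 2 ≤ ‖D‖ ^ 2 := pow_le_pow_left₀ (norm_nonneg _) (hA D) 2
  rw [show B + D - (B + (1 - t) • D) = t • D by module, real_inner_smul_right, h_norm, h_norm_X]
    at h_sub
  rw [show B + D + t • (B - (B + D)) = B + (1 - t) • D by module, add_sub_cancel_left,
    regFunctional_eq hμ.le, regFunctional_eq hμ.le, h_res, h_res_X]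
  rw [inner_sub_left] at h_mono_D
  nlinarith [mul_le_mul_of_nonneg_left h_mono_D ht0,
    mul_nonneg (mul_nonneg ht0 ht0) (sub_nonneg.2 hAD),
    mul_nonneg (mul_nonneg ht0 ht0) (mul_nonneg hγ.le (sq_nonneg ‖D‖))]

theorem HasSpectralGap.eq_of_isStationaryPt (hB : HasSpectralGap A b μ γ B) (hμ : 0 < μ)
    (hA : ∀ X, ‖A X‖ ≤ ‖X‖) (hγ : 0 < γ) {X : Matrix (Fin n₁) (Fin n₂) 𝕜} {s : ℝ} (hs : 0 ≤ s)
    (hγs : γ < s ^ 2) (hXB : s * ‖X - B‖ ≤ ‖A (X - B)‖)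
    (hX : IsStationaryPt (regFunctional A b μ) X) : X = B := by
  by_contra hne
  have hD : 0 < ‖X - B‖ := norm_pos_iff.2 (sub_ne_zero.2 hne)
  have hs1 : s ^ 2 ≤ 1 :=
    pow_le_one₀ hs (le_of_mul_le_mul_right (by simpa using hXB.trans (hA _)) hD)
  have h_lower : s ^ 2 * ‖X - B‖ ^ 2 ≤ ‖A (X - B)‖ ^ 2 := by
    rw [← mul_pow]
    exact pow_le_pow_left₀ (by positivity) hXB 2
  have h_small : ∀ᶠ t : ℝ in 𝓝[>] 0, t < (s ^ 2 - γ) / 2 :=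
    (eventually_lt_nhds (by linarith)).filter_mono nhdsWithin_le_nhds
  obtain ⟨t, ⟨h_stat, ht⟩, ht0 : 0 < t⟩ :=
    (((hX.eventually_lt (mul_pos (sub_pos.2 hγs) (pow_pos hD 2)) (B - X)).and h_small).and
      self_mem_nhdsWithin).exists
  have h_descent := hB.regFunctional_add_smul_le hμ hA hγ (hγs.trans_le hs1) X ht0.le
    (by linarith)
  have h_rate : (s ^ 2 - γ) * ‖X - B‖ ^ 2 ≤ 2 * (‖A (X - B)‖ ^ 2 - (γ + t) * ‖X - B‖ ^ 2) := by
    nlinarith [mul_le_mul_of_nonneg_right ht.le (sq_nonneg ‖X - B‖)]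
  linarith [mul_le_mul_of_nonneg_left h_rate ht0.le]

end StationaryPoints

section BestRankSolutions

variable {F : Type*} [NormedAddCommGroup F] [InnerProductSpace ℝ F]

theorem inner_sub_map_eq_zero_of_forall_norm_sub_le {E : Type*} [AddCommGroup E] [Module ℝ E]
    {A : E →ₗ[ℝ] F} {b : F} {X D : E} (h : ∀ t : ℝ, ‖A X - b‖ ≤ ‖A (X + t • D) - b‖) :
    inner ℝ (b - A X) (A D) = 0 := by
  have h_quad (t : ℝ) : 0 ≤ ‖A D‖ ^ 2 * (t * t) + -2 * inner ℝ (b - A X) (A D) * t + 0 := by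
    have h_sq := pow_le_pow_left₀ (norm_nonneg _) (h t) 2
    rw [norm_sub_rev, norm_sub_rev _ b, map_add, map_smul, ← sub_sub, norm_sub_sq_real (b - A X),
      real_inner_smul_right, norm_smul, mul_pow, Real.norm_eq_abs, sq_abs] at h_sq
    linarith
  have h_discrim := discrim_le_zero h_quad
  rw [discrim] at h_discrim
  exact pow_eq_zero_iff two_ne_zero |>.1 (le_antisymm (by linarith) (sq_nonneg _))

variable {𝕜 : Type*} [RCLike 𝕜] {n₁ n₂ : ℕ} {A : Matrix (Fin n₁) (Fin n₂) 𝕜 →ₗ[ℝ] F} {b : F}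
  {B X₀ : Matrix (Fin n₁) (Fin n₂) 𝕜} {K : ℕ}

theorem norm_map_le_opNorm_mul_norm (A : Matrix (Fin n₁) (Fin n₂) 𝕜 →ₗ[ℝ] F)
    (X : Matrix (Fin n₁) (Fin n₂) 𝕜) : ‖A X‖ ≤ opNorm A * ‖X‖ := by
  rcases eq_or_ne X 0 with rfl | hX
  · simp
  · obtain ⟨C, hC, hbound⟩ := SemilinearMapClass.bound_of_continuous A
      A.continuous_of_finiteDimensional
    rw [← div_le_iff₀ (norm_pos_iff.2 hX)]
    refine le_csInf ⟨C, hC.le, hbound⟩ fun c hc => ?_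
    exact (div_le_iff₀ (norm_pos_iff.2 hX)).2 (hc.2 X)

theorem norm_map_lt_one_of_opNorm_lt_one (hA : opNorm A < 1) {X : Matrix (Fin n₁) (Fin n₂) 𝕜}
    (hX : ‖X‖ ≤ 1) : ‖A X‖ < 1 :=
  calc ‖A X‖ ≤ opNorm A * ‖X‖ := norm_map_le_opNorm_mul_norm A X
    _ ≤ opNorm A := mul_le_of_le_one_right (Real.sInf_nonneg fun _ hc => hc.1) hX
    _ < 1 := hA

theorem norm_map_le_norm_of_opNorm_le_one (hA : opNorm A ≤ 1) (X : Matrix (Fin n₁) (Fin n₂) 𝕜) :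
    ‖A X‖ ≤ ‖X‖ :=
  (norm_map_le_opNorm_mul_norm A X).trans (mul_le_of_le_one_left (norm_nonneg X) hA)

theorem sqrt_one_sub_lripConst_mul_norm_le (A : Matrix (Fin n₁) (Fin n₂) 𝕜 →ₗ[ℝ] F)
    {X : Matrix (Fin n₁) (Fin n₂) 𝕜} (hX : X.rank ≤ K) :
    √(1 - lripConst A K) * ‖X‖ ≤ ‖A X‖ := by
  rcases eq_or_ne X 0 with rfl | h0
  · simp
  · rw [← le_div_iff₀ (norm_pos_iff.2 h0)]
    refine Real.sqrt_le_iff.2 ⟨by positivity, ?_⟩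
    rw [lripConst, sub_sub_cancel, div_pow]
    exact csInf_le ⟨0, by rintro _ ⟨Y, -, -, rfl⟩; positivity⟩ ⟨X, h0, hX, rfl⟩

theorem lripConst_nonneg (hA : opNorm A ≤ 1) (K : ℕ) : 0 ≤ lripConst A K := by
  rw [lripConst, sub_nonneg]
  by_contra! h
  obtain ⟨q, X, h0, hX, rfl⟩ : {q : ℝ | ∃ X : Matrix (Fin n₁) (Fin n₂) 𝕜, X ≠ 0 ∧ X.rank ≤ K ∧
      q = ‖A X‖ ^ 2 / ‖X‖ ^ 2}.Nonempty := by
    by_contra! h_empty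
    rw [h_empty, Real.sInf_empty] at h
    linarith
  have h_sq := pow_le_pow_left₀ (norm_nonneg _) (norm_map_le_norm_of_opNorm_le_one hA X) 2
  exact (h.trans_le (csInf_le ⟨0, by rintro _ ⟨Y, -, -, rfl⟩; positivity⟩ ⟨X, h0, hX, rfl⟩)).not_ge
    (div_le_one_of_le₀ h_sq (sq_nonneg _))

theorem exists_mem_bestRankSolutions {s : ℝ} (hs : 0 < s) (b : F)
    (hrip : ∀ X : Matrix (Fin n₁) (Fin n₂) 𝕜, X.rank ≤ K → s * ‖X‖ ≤ ‖A X‖) :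
    ∃ X, X ∈ bestRankSolutions A b K := by
  have : ProperSpace (Matrix (Fin n₁) (Fin n₂) 𝕜) := FiniteDimensional.proper ℝ _
  have h_cont : Continuous fun X => ‖A X - b‖ :=
    (A.continuous_of_finiteDimensional.sub continuous_const).norm
  have h_coercive : ∀ᶠ X in cocompact (Matrix (Fin n₁) (Fin n₂) 𝕜) ⊓ 𝓟 {X | X.rank ≤ K},
      ‖A 0 - b‖ ≤ ‖A X - b‖ := by
    rw [eventually_inf_principal]
    filter_upwards [(tendsto_norm_cocompact_atTop).eventually_ge_atTop (2 * ‖b‖ / s)] with X hX h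
    rw [map_zero, zero_sub, norm_neg]
    have h_far : 2 * ‖b‖ ≤ ‖A X‖ := ((div_le_iff₀' hs).1 hX).trans (hrip X h)
    linarith [norm_le_norm_sub_add (A X) b]
  obtain ⟨X, hX, hmin⟩ := h_cont.continuousOn.exists_isMinOn' (isClosed_setOf_rank_le K)
    (by simp) h_coercive
  exact ⟨X, hX, fun Y hY => hmin hY⟩

theorem norm_sub_le_of_mem_bestRankSolutions {s : ℝ} (hs : 0 < s)
    (hrip : ∀ X : Matrix (Fin n₁) (Fin n₂) 𝕜, X.rank ≤ 2 * K → s * ‖X‖ ≤ ‖A X‖)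
    (hB : B ∈ bestRankSolutions A b K) (hX₀ : X₀.rank ≤ K) :
    ‖B - X₀‖ ≤ 2 * ‖A X₀ - b‖ / s := by
  rw [le_div_iff₀' hs]
  calc s * ‖B - X₀‖ ≤ ‖A (B - X₀)‖ :=
        hrip _ ((rank_sub_le_rank_add_rank B X₀).trans (by linarith [hB.1]))
    _ ≤ ‖A B - b‖ + ‖A X₀ - b‖ := by
        rw [map_sub, ← sub_sub_sub_cancel_right _ _ b]
        exact norm_sub_le _ _
    _ ≤ 2 * ‖A X₀ - b‖ := by linarith [hB.2 X₀ hX₀]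

theorem singVal_sub_norm_sub_le_singularValues (hB : B.rank ≤ K) (X₀ : Matrix (Fin n₁) (Fin n₂) 𝕜)
    {j : ℕ} (hj : (Matrix.toEuclideanLin B).singularValues j ≠ 0) :
    singVal X₀ K - ‖B - X₀‖ ≤ (Matrix.toEuclideanLin B).singularValues j := by
  rw [Ne, singularValues_eq_zero_iff_rank_le, not_le] at hj
  have h_anti := LinearMap.singularValues_antitone (Matrix.toEuclideanLin B)
    (show j ≤ K - 1 by omega)
  rw [singVal]
  linarith [singularValues_le_norm_sub_add X₀ B (K - 1)]

theorem HasSpectralGap.of_mem_bestRankSolutions {μ γ : ℝ} (hγ : 0 ≤ γ)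
    (hB : B ∈ bestRankSolutions A b K) (hres : ‖A B - b‖ ≤ γ * √μ)
    (hgap : √μ ≤ γ * (singVal X₀ K - ‖B - X₀‖)) : HasSpectralGap A b μ γ B where
  norm_residual_le := by rwa [norm_sub_rev]
  eq_zero_or_le j := or_iff_not_imp_left.2 fun hj => hgap.trans
    (mul_le_mul_of_nonneg_left (singVal_sub_norm_sub_le_singularValues hB.1 X₀ hj) hγ)
  inner_map_mul_right Z := inner_sub_map_eq_zero_of_forall_norm_sub_le fun t => hB.2 _ <| by
    have h : B + t • (B * Z) = B * (1 + t • Z) := by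
      rw [Matrix.mul_add, Matrix.mul_one, Matrix.mul_smul]
    exact h ▸ (Matrix.rank_mul_le_left _ _).trans hB.1
  inner_map_mul_left Z := inner_sub_map_eq_zero_of_forall_norm_sub_le fun t => hB.2 _ <| by
    have h : B + t • (Z * B) = (1 + t • Z) * B := by
      rw [Matrix.add_mul, Matrix.one_mul, Matrix.smul_mul]
    exact h ▸ (Matrix.rank_mul_le_right _ _).trans hB.1

theorem lt_sq_of_sqrt_mul_le {m μ τ e r : ℝ} (hm : 1 ≤ m) (hμ : 0 ≤ μ) (he : 0 ≤ e)
    (hτ : √μ + 2 * e < τ) (h : √m * τ ≤ r + e) : m * μ + e ^ 2 < r ^ 2 := by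
  have hμτ : √μ < τ := by linarith
  have h_one : 1 ≤ √m := Real.one_le_sqrt.2 hm
  have hm_sq : √m * √m = m := Real.mul_self_sqrt (by linarith)
  have h_main : μ < τ * (τ - 2 * e) :=
    calc μ = √μ * √μ := (Real.mul_self_sqrt hμ).symm
      _ < τ * (τ - 2 * e) :=
        mul_lt_mul'' hμτ (by linarith) (Real.sqrt_nonneg _) (Real.sqrt_nonneg _)
  have hτ0 : 0 < τ := (Real.sqrt_nonneg μ).trans_lt hμτ
  calc m * μ + e ^ 2 < m * (τ * (τ - 2 * e)) + e ^ 2 := by gcongr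
    _ = (√m * τ) ^ 2 - 2 * m * τ * e + e ^ 2 := by rw [mul_pow, sq (√m), hm_sq]; ring
    _ ≤ (√m * τ) ^ 2 - 2 * √m * τ * e + e ^ 2 := by
        have : √m ≤ m := by nlinarith
        gcongr
    _ = (√m * τ - e) ^ 2 := by ring
    _ ≤ r ^ 2 := by
        refine pow_le_pow_left₀ ?_ (by linarith) 2
        nlinarith [Real.sqrt_nonneg μ]

theorem rankFunctional_lt_of_rank_lt {μ s : ℝ} (hs : 0 ≤ s)
    (hrip : ∀ X : Matrix (Fin n₁) (Fin n₂) 𝕜, X.rank ≤ 2 * X₀.rank → s * ‖X‖ ≤ ‖A X‖)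
    (hμ : 0 ≤ μ) (hsignal : √μ + 2 * ‖A X₀ - b‖ < s * singVal X₀ X₀.rank)
    {Y : Matrix (Fin n₁) (Fin n₂) 𝕜} (hY : Y.rank < X₀.rank) :
    rankFunctional A b μ X₀ < rankFunctional A b μ Y := by
  set m : ℝ := X₀.rank - Y.rank with hm_def
  have hm : 1 ≤ m := by
    rw [hm_def, le_sub_iff_add_le']
    exact_mod_cast hY
  have h_eckart_young : m * singVal X₀ X₀.rank ^ 2 ≤ ‖Y - X₀‖ ^ 2 := by
    have hY0 := singularValues_eq_zero_iff_rank_le.2 (le_refl Y.rank)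
    have h := sub_mul_singularValues_sub_sq_le X₀ Y (k := X₀.rank - 1) (m := Y.rank)
      (hY0.trans_le (LinearMap.singularValues_nonneg _ _))
    rwa [hY0, sub_zero, Nat.cast_pred (by omega), sub_add_cancel, ← hm_def] at h
  have h_misfit : √m * (s * singVal X₀ X₀.rank) ≤ ‖A Y - b‖ + ‖A X₀ - b‖ :=
    calc √m * (s * singVal X₀ X₀.rank) = s * (√m * singVal X₀ X₀.rank) := mul_left_comm _ _ _
      _ ≤ s * ‖Y - X₀‖ := by
          refine mul_le_mul_of_nonneg_left (abs_le_of_sq_le_sq' ?_ (norm_nonneg _)).2 hs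
          rwa [mul_pow, Real.sq_sqrt (by linarith)]
      _ ≤ ‖A (Y - X₀)‖ := hrip _ ((rank_sub_le_rank_add_rank Y X₀).trans (by omega))
      _ ≤ ‖A Y - b‖ + ‖A X₀ - b‖ := by
          rw [map_sub, ← sub_sub_sub_cancel_right _ _ b]
          exact norm_sub_le _ _
  have h_lt := lt_sq_of_sqrt_mul_le hm hμ (norm_nonneg (A X₀ - b)) hsignal h_misfit
  rw [rankFunctional, rankFunctional]
  rw [hm_def] at h_lt
  linarith

theorem rankFunctional_lt_of_rank_gt {μ : ℝ} (hnoise : ‖A X₀ - b‖ < √μ)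
    {Y : Matrix (Fin n₁) (Fin n₂) 𝕜} (hY : X₀.rank < Y.rank) :
    rankFunctional A b μ X₀ < rankFunctional A b μ Y := by
  have h_rank : (X₀.rank : ℝ) + 1 ≤ Y.rank := by exact_mod_cast hY
  have hμ : 0 ≤ μ := (Real.sqrt_pos.1 ((norm_nonneg _).trans_lt hnoise)).le
  calc μ * X₀.rank + ‖A X₀ - b‖ ^ 2 < μ * (X₀.rank + 1) := by
        rw [mul_add_one]
        exact add_lt_add_right ((Real.lt_sqrt (norm_nonneg _)).1 hnoise) _
    _ ≤ μ * Y.rank := mul_le_mul_of_nonneg_left h_rank hμ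
    _ ≤ rankFunctional A b μ Y := le_add_of_nonneg_right (sq_nonneg _)

theorem add_two_mul_lt_mul_of_le_mul_sub {a e s γ σ : ℝ} (ha : 0 < a) (hγ : 0 < γ)
    (hγs : γ < s ^ 2) (hs : 0 < s) (hs_one : s ≤ 1) (h : a ≤ γ * (σ - 2 * e / s)) :
    a + 2 * e < s * σ := by
  have h_pos : 0 < σ - 2 * e / s := pos_of_mul_pos_right (ha.trans_le h) hγ.le
  calc a + 2 * e ≤ γ * (σ - 2 * e / s) + 2 * e := by linarith
    _ < s * (σ - 2 * e / s) + 2 * e := by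
        have : γ < s := by nlinarith
        gcongr
    _ = s * σ := by field_simp; ring

theorem rankFunctional_lt_of_rank_ne {μ γ s : ℝ} (hs : 0 < s) (hs_one : s ≤ 1)
    (hrip : ∀ X : Matrix (Fin n₁) (Fin n₂) 𝕜, X.rank ≤ 2 * X₀.rank → s * ‖X‖ ≤ ‖A X‖)
    (hμ : 0 < μ) (hγ : 0 < γ) (hγs : γ < s ^ 2) (hnoise : ‖A X₀ - b‖ ≤ γ * √μ)
    (hsignal : √μ ≤ γ * (singVal X₀ X₀.rank - 2 * ‖A X₀ - b‖ / s))
    {Y : Matrix (Fin n₁) (Fin n₂) 𝕜} (hY : Y.rank ≠ X₀.rank) :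
    rankFunctional A b μ X₀ < rankFunctional A b μ Y := by
  have h_sqrt_μ : 0 < √μ := Real.sqrt_pos.2 hμ
  rcases hY.lt_or_gt with hY | hY
  · exact rankFunctional_lt_of_rank_lt hs.le hrip hμ.le
      (add_two_mul_lt_mul_of_le_mul_sub h_sqrt_μ hγ hγs hs hs_one hsignal) hY
  · have hγ_one : γ < 1 := hγs.trans_le (pow_le_one₀ hs.le hs_one)
    exact rankFunctional_lt_of_rank_gt
      (hnoise.trans_lt (mul_lt_of_lt_one_left h_sqrt_μ hγ_one)) hY

theorem globalMinimizers_rankFunctional {μ : ℝ} (hμ : 0 ≤ μ)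
    (h : ∀ Y : Matrix (Fin n₁) (Fin n₂) 𝕜, Y.rank ≠ X₀.rank →
      rankFunctional A b μ X₀ < rankFunctional A b μ Y) :
    globalMinimizers (rankFunctional A b μ) = bestRankSolutions A b X₀.rank := by
  have h_le {X : Matrix (Fin n₁) (Fin n₂) 𝕜} (hX : X.rank ≤ X₀.rank) :
      rankFunctional A b μ X ≤ μ * X₀.rank + ‖A X - b‖ ^ 2 := by
    rw [rankFunctional]; gcongr
  ext X
  refine ⟨fun hX => ?_, fun hX Y => (h_le hX.1).trans ?_⟩
  · have hrank : X.rank = X₀.rank := by_contra fun hne => (h X hne).not_ge (hX X₀)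
    refine ⟨hrank.le, fun Y hY => ?_⟩
    have h_XY := (hX Y).trans (h_le hY)
    rw [rankFunctional, hrank] at h_XY
    exact (pow_le_pow_iff_left₀ (norm_nonneg _) (norm_nonneg _) two_ne_zero).1
      (le_of_add_le_add_left h_XY)
  · by_cases hY : Y.rank = X₀.rank
    · rw [rankFunctional, hY]
      gcongr
      exact hX.2 Y hY.le
    · refine le_trans ?_ (h Y hY).le
      rw [rankFunctional]
      gcongr
      exact hX.2 X₀ le_rfl

end BestRankSolutions

theorem theorem1p1_general {𝕜 : Type*} [RCLike 𝕜] {n₁ n₂ : ℕ}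
    {F : Type*} [NormedAddCommGroup F] [InnerProductSpace ℝ F]
    (A : Matrix (Fin n₁) (Fin n₂) 𝕜 →ₗ[ℝ] F) (hA : opNorm A < 1)
    (X₀ : Matrix (Fin n₁) (Fin n₂) 𝕜) (ε b : F) (hb : b = A X₀ + ε)
    (K : ℕ) (hX₀ : X₀.rank = K) (μ : ℝ) (hμ : 0 < μ)
    (γ : ℝ) (hγ : γ < 1 - lripConst A (2 * K)) (hε : ‖ε‖ ≤ γ * √μ)
    (hσ : √μ ≤ γ * (singVal X₀ K - 2 * ‖ε‖ / √(1 - lripConst A (2 * K)))) :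
    ∃ X_B : Matrix (Fin n₁) (Fin n₂) 𝕜,
      bestRankSolutions A b K = {X_B} ∧
      globalMinimizers (regFunctional A b μ) = {X_B} ∧
      globalMinimizers (rankFunctional A b μ) = {X_B} ∧
      ‖X_B - X₀‖ ≤ 2 * ‖ε‖ / √(1 - lripConst A (2 * K)) ∧
      IsStationaryPt (regFunctional A b μ) X_B ∧
      ∀ X : Matrix (Fin n₁) (Fin n₂) 𝕜,
        IsStationaryPt (regFunctional A b μ) X → X ≠ X_B → K < X.rank := by
  subst hX₀
  have h_noise : ‖A X₀ - b‖ = ‖ε‖ := by rw [hb, sub_add_cancel_left, norm_neg]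
  have h_sqrt_μ : 0 < √μ := Real.sqrt_pos.2 hμ
  have hγ_pos : 0 < γ := (nonneg_of_mul_nonneg_left ((norm_nonneg ε).trans hε) h_sqrt_μ).lt_of_ne
    fun h => h_sqrt_μ.not_ge (by rwa [← h, zero_mul] at hσ)
  have h_rip (X : Matrix (Fin n₁) (Fin n₂) 𝕜) (hX : X.rank ≤ 2 * X₀.rank) :=
    sqrt_one_sub_lripConst_mul_norm_le A hX
  have hs_one : √(1 - lripConst A (2 * X₀.rank)) ≤ 1 :=
    Real.sqrt_le_one.2 (sub_le_self 1 (lripConst_nonneg hA.le _))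
  have hs : 0 < √(1 - lripConst A (2 * X₀.rank)) := Real.sqrt_pos.2 (hγ_pos.trans hγ)
  rw [← Real.sq_sqrt (hγ_pos.trans hγ).le] at hγ
  rw [← h_noise] at hε hσ ⊢
  generalize √(1 - lripConst A (2 * X₀.rank)) = s at *
  have h_rank := globalMinimizers_rankFunctional hμ.le fun _ =>
    rankFunctional_lt_of_rank_ne hs hs_one h_rip hμ hγ_pos hγ hε hσ
  have h_reg := (globalMinimizers_regFunctional (b := b) hμ.le fun _ =>
    norm_map_lt_one_of_opNorm_lt_one hA).trans h_rank
  obtain ⟨B, hB⟩ := exists_mem_bestRankSolutions hs b fun X hX =>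
    h_rip X (hX.trans (Nat.le_mul_of_pos_left _ two_pos))
  have h_dist := norm_sub_le_of_mem_bestRankSolutions hs h_rip hB le_rfl
  have h_gap : HasSpectralGap A b μ γ B := .of_mem_bestRankSolutions hγ_pos.le hB
    ((hB.2 X₀ le_rfl).trans hε) (hσ.trans (by gcongr))
  have h_unique {X : Matrix (Fin n₁) (Fin n₂) 𝕜} (hX : IsStationaryPt (regFunctional A b μ) X)
      (hXK : X.rank ≤ X₀.rank) : X = B :=
    h_gap.eq_of_isStationaryPt hμ (norm_map_le_norm_of_opNorm_le_one hA.le) hγ_pos hs.le hγ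
      (h_rip _ ((rank_sub_le_rank_add_rank X B).trans (by linarith [hB.1]))) hX
  have h_best : bestRankSolutions A b X₀.rank = {B} := Set.eq_singleton_iff_unique_mem.2
    ⟨hB, fun X hX => h_unique (isStationaryPt_of_mem_globalMinimizers (h_reg ▸ hX)) hX.1⟩
  exact ⟨B, h_best, h_reg.trans h_best, h_rank.trans h_best, h_dist,
    isStationaryPt_of_mem_globalMinimizers (h_reg ▸ hB),
    fun X hX hne => not_le.1 fun h => hne (h_unique hX h)⟩

theorem exists_gap_parameter {c a e σ : ℝ} (hc : 0 < c) (hc_one : c ≤ 1) (ha : 0 ≤ a)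
    (he : e ≤ c ^ (3 / 2 : ℝ) * a / 3) (hσ : (1 / c + c) * a ≤ σ) :
    ∃ γ < c, e ≤ γ * a ∧ a ≤ γ * (σ - 2 * e / √c) := by
  have h_pow : c ^ (3 / 2 : ℝ) = c * √c := by
    rw [show (3 / 2 : ℝ) = 1 + 1 / 2 by norm_num, Real.rpow_add hc, Real.rpow_one,
      Real.sqrt_eq_rpow]
  rw [h_pow] at he
  -- `1 / γ = 1 / c + c / 3`, since `2 * e / √c` uses up at most `2 / 3` of the second summand `c`.
  refine ⟨3 * c / (3 + c ^ 2), ?_, ?_, ?_⟩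
  · rw [div_lt_iff₀ (by positivity)]
    nlinarith [pow_pos hc 3]
  · have h_coeff : c * √c / 3 ≤ 3 * c / (3 + c ^ 2) :=
      calc c * √c / 3 ≤ c * 1 / 3 := by gcongr; exact Real.sqrt_le_one.2 hc_one
        _ ≤ 3 * c / (3 + c ^ 2) := by
          rw [div_le_div_iff₀ three_pos (by positivity)]
          nlinarith
    calc e ≤ c * √c / 3 * a := by linarith
      _ ≤ 3 * c / (3 + c ^ 2) * a := by gcongr
  · have h_noise : 2 * e / √c ≤ 2 / 3 * c * a := by
      rw [div_le_iff₀ (Real.sqrt_pos.2 hc)]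
      linarith
    calc a = 3 * c / (3 + c ^ 2) * ((1 / c + c / 3) * a) := by field_simp
      _ ≤ 3 * c / (3 + c ^ 2) * (σ - 2 * e / √c) := by gcongr; linarith

end

/-- `A` is an arbitrary real-linear operator from the real or complex `n₁ × n₂` matrices (with the
Frobenius norm) to a finite-dimensional real inner product space `F`, e.g. `ℝᵐ`, or `ℂᵐ` viewed as
a real space; `opNorm A` is its operator norm. -/
theorem theorem1p1 {𝕜 : Type*} [RCLike 𝕜] {n₁ n₂ : ℕ}
    {F : Type*} [NormedAddCommGroup F] [InnerProductSpace ℝ F] [FiniteDimensional ℝ F]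
    (A : Matrix (Fin n₁) (Fin n₂) 𝕜 →ₗ[ℝ] F) (hA : opNorm A < 1)
    (X₀ : Matrix (Fin n₁) (Fin n₂) 𝕜) (ε b : F) (hb : b = A X₀ + ε)
    (K : ℕ) (hK : 1 ≤ K) (hX₀ : X₀.rank = K)
    (hδ : lripConst A (2 * K) < 1)
    (μ : ℝ) (hμ : 0 < μ)
    (hε : ‖ε‖ ≤ (1 - lripConst A (2 * K)) ^ (3 / 2 : ℝ) * √μ / 3)
    (hσ : singVal X₀ K >
      (1 / (1 - lripConst A (2 * K)) + (1 - lripConst A (2 * K))) * √μ) :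
    ∃ X_B : Matrix (Fin n₁) (Fin n₂) 𝕜,
      bestRankSolutions A b K = {X_B} ∧
      globalMinimizers (regFunctional A b μ) = {X_B} ∧
      globalMinimizers (rankFunctional A b μ) = {X_B} ∧
      ‖X_B - X₀‖ ≤ 2 * ‖ε‖ / √(1 - lripConst A (2 * K)) ∧
      IsStationaryPt (regFunctional A b μ) X_B ∧
      ∀ X : Matrix (Fin n₁) (Fin n₂) 𝕜,
        IsStationaryPt (regFunctional A b μ) X → X ≠ X_B → K < X.rank := by
  obtain ⟨γ, hγ, hεγ, hσγ⟩ := exists_gap_parameter (sub_pos.2 hδ)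
    (sub_le_self 1 (lripConst_nonneg hA.le _)) (Real.sqrt_nonneg μ) hε hσ.le
  exact theorem1p1_general A hA X₀ ε b hb K hX₀ μ hμ γ hγ hεγ hσγ
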